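/- Let $M$ be an oriented matroid on a finite linearly ordered set $E$; every minor of $M$ is ordered by the induced order, and $\subset$ denotes strict inclusion. A circuit or cocircuit is positive if all its signs are positive; a positive circuit or cocircuit is identified with its support. Call $M$ acyclic if it has no positive circuit, and totally cyclic if every element belongs to a positive circuit. Call $M$ bounded with respect to $p\in E$ if it is acyclic and every positive cocircuit contains $p$, and dual-bounded with respect to $p\in E$ if it is totally cyclic and every positive circuit contains $p$. For $F\subseteq E$, $M(F)$ denotes the restriction of $M$ to $F$ and $M/F$ the contraction of $F$. A filtration of $M$ is a sequence $(F'_\varepsilon,\dots,F'_0,F_c,F_0,\dots,F_\iota)$ of subsets of $E$, with $\iota,\varepsilon\ge 0$, such that $$\emptyset=F'_\varepsilon\subset\dots\subset F'_0=F_c=F_0\subset\dots\subset F_\iota=E,$$ $\min(F_k\setminus F_{k-1})$ is increasing with $k$ for $1\le k\le\iota$, and $\min(F'_{k-1}\setminus F'_k)$ is increasing with $k$ for $1\le k\le\varepsilon$. It is a connected filtration if moreover, for $1\le k\le\iota$, the underlying matroid of $M(F_k)/F_{k-1}$ is connected (any two distinct elements lie in a common circuit) and is not a single loop, and, for $1\le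 k\le\varepsilon$, the underlying matroid of $M(F'_{k-1})/F'_k$ is connected and is not a single isthmus (coloop). Let $a_1<\dots<a_\iota$ be the elements of $E$ that are the smallest element of some positive cocircuit of $M$, and $a'_1<\dots<a'_\varepsilon$ those that are the smallest element of some positive circuit of $M$. The active filtration of $M$ is the sequence $(F'_\varepsilon,\dots,F'_0,F_c,F_0,\dots,F_\iota)$ where $F_c$ is the union of all positive circuits of $M$, $F_\iota=E$, $F'_\varepsilon=\emptyset$, $$F_k=E\setminus\bigcup_{\substack{D\text{ positive cocircuit}\\ \min(D)\ge a_{k+1}}}D\quad(0\le k\le\iota-1),\qquad F'_k=\bigcup_{\substack{C\text{ positive circuit}\\ \min(C)\ge a'_{k+1}}}C\quad(0\le k\le\varepsilon-1).$$ Theorem. The active filtration of $M$ is a connected filtration of $M$. It is the unique filtration $(F'_\varepsilon,\dots,F'_0,F_c,F_0,\dots,F_\iota)$ of $M$ (with $\iota$ and $\varepsilon$ not prescribed) such that the minors $M(F_k)/F_{k-1}$, $1\le k\le\iota$, are bounded with respect to $\min(F_k\setminus F_{k-1})$ and the minors $M(F'_{k-1})/F'_k$, $1\le k\le\varepsilon$,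 are dual-bounded with respect to $\min(F'_{k-1}\setminus F'_k)$. -/

import Mathlib

/-! ### Sign vectors -/

namespace SignVec

variable {α : Type*}

/-- Composition `X ∘ Y` of sign vectors. -/
def comp (X Y : α → SignType) : α → SignType :=
  fun e => if X e = 0 then Y e else X e

/-- The separation set `S(X, Y)`: elements at which `X` and `Y` have opposite nonzero signs. -/
def sep (X Y : α → SignType) : Set α :=
  {e | X e ≠ 0 ∧ X e = - Y e}

/-- Orthogonality of sign vectors: either the supports are disjoint, or the two vectors agree
at some common element of the supports and are opposite at another one. -/
def Orthogonal (X Y : α → SignType) : Prop :=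
  (∀ e, X e * Y e = 0) ∨ ((∃ e, X e * Y e = 1) ∧ (∃ e, X e * Y e = -1))

/-- `X` is a nonzero member of `S` whose support is inclusion-minimal among the supports of
nonzero members of `S`. -/
def IsMinSupport (S : Set (α → SignType)) (X : α → SignType) : Prop :=
  X ∈ S ∧ X ≠ 0 ∧
    ∀ Y ∈ S, Y ≠ 0 → Function.support Y ⊆ Function.support X →
      Function.support Y = Function.support X

end SignVec

/-- An oriented matroid on a finite ground set `E ⊆ α`, given by its covectors.
A sign vector on `E` is encoded as a function `α → SignType` that vanishes outside `E`. -/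
structure OrientedMatroid (α : Type*) where
  /-- ground set -/
  E : Set α
  finite_ground : E.Finite
  /-- covectors -/
  covectors : Set (α → SignType)
  support_subset : ∀ X ∈ covectors, Function.support X ⊆ E
  zero_mem : (0 : α → SignType) ∈ covectors
  neg_mem : ∀ X ∈ covectors, -X ∈ covectors
  comp_mem : ∀ X ∈ covectors, ∀ Y ∈ covectors, SignVec.comp X Y ∈ covectors
  elimination : ∀ X ∈ covectors, ∀ Y ∈ covectors, ∀ e ∈ SignVec.sep X Y,
    ∃ Z ∈ covectors, Z e = 0 ∧ ∀ f ∉ SignVec.sep X Y, Z f = SignVec.comp X Y f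

namespace OrientedMatroid

variable {α : Type*}

/-- The vectors: sign vectors on the ground set orthogonal to all covectors. -/
def vectors (M : OrientedMatroid α) : Set (α → SignType) :=
  {V | Function.support V ⊆ M.E ∧ ∀ X ∈ M.covectors, SignVec.Orthogonal V X}

/-- Signed circuits: nonzero vectors of minimal support. -/
def IsCircuit (M : OrientedMatroid α) (C : α → SignType) : Prop :=
  SignVec.IsMinSupport M.vectors C

/-- Signed cocircuits: nonzero covectors of minimal support. -/
def IsCocircuit (M : OrientedMatroid α) (D : α → SignType) : Prop :=
  SignVec.IsMinSupport M.covectors D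

/-- The set `C` is (the support of) a positive circuit: a signed circuit all of whose signs
are `+`. -/
def IsPosCircuit (M : OrientedMatroid α) (C : Set α) : Prop :=
  ∃ X, M.IsCircuit X ∧ (∀ e, 0 ≤ X e) ∧ Function.support X = C

/-- The set `D` is (the support of) a positive cocircuit. -/
def IsPosCocircuit (M : OrientedMatroid α) (D : Set α) : Prop :=
  ∃ X, M.IsCocircuit X ∧ (∀ e, 0 ≤ X e) ∧ Function.support X = D

/-! ### Minors -/

/-- The restriction `M(F)`: its covectors are the restrictions to `F` of the covectors. -/
noncomputable def restrict (M : OrientedMatroid α) (F : Set α) : OrientedMatroid α where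
  E := M.E ∩ F
  finite_ground := M.finite_ground.subset Set.inter_subset_left
  covectors := (fun X => F.indicator X) '' M.covectors
  support_subset := by
    rintro _ ⟨X, hX, rfl⟩ e he
    rw [Function.mem_support, Set.indicator_apply_ne_zero] at he
    exact ⟨M.support_subset X hX he.2, he.1⟩
  zero_mem := ⟨0, M.zero_mem, by simp⟩
  neg_mem := by
    rintro _ ⟨X, hX, rfl⟩
    refine ⟨-X, M.neg_mem X hX, ?_⟩
    funext e
    by_cases he : e ∈ F <;> simp [he]
  comp_mem := by
    rintro _ ⟨X, hX, rfl⟩ _ ⟨Y, hY, rfl⟩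
    refine ⟨_, M.comp_mem X hX Y hY, ?_⟩
    funext e
    by_cases he : e ∈ F <;> simp [he, SignVec.comp]
  elimination := by
    rintro _ ⟨X, hX, rfl⟩ _ ⟨Y, hY, rfl⟩ e ⟨he0, he⟩
    have heF : e ∈ F := (Set.indicator_apply_ne_zero.1 he0).1
    simp only [Set.indicator_of_mem heF] at he0 he
    obtain ⟨Z, hZ, hZe, hZf⟩ := M.elimination X hX Y hY e ⟨he0, he⟩
    refine ⟨_, ⟨Z, hZ, rfl⟩, by simp [hZe], fun f hf => ?_⟩
    by_cases hfF : f ∈ F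
    · have : f ∉ SignVec.sep X Y := by simpa [SignVec.sep, hfF] using hf
      simpa [hfF, SignVec.comp] using hZf f this
    · simp [hfF, SignVec.comp]

/-- The contraction `M / A`: its covectors are the covectors that vanish on `A`. -/
def contract (M : OrientedMatroid α) (A : Set α) : OrientedMatroid α where
  E := M.E \ A
  finite_ground := M.finite_ground.subset Set.sdiff_subset
  covectors := {X | X ∈ M.covectors ∧ ∀ e ∈ A, X e = 0}
  support_subset := fun X hX e he => ⟨M.support_subset X hX.1 he, fun hA => he (hX.2 e hA)⟩
  zero_mem := ⟨M.zero_mem, fun _ _ => rfl⟩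
  neg_mem := fun X hX => ⟨M.neg_mem X hX.1, fun e he => by simp [hX.2 e he]⟩
  comp_mem := fun X hX Y hY =>
    ⟨M.comp_mem X hX.1 Y hY.1, fun e he => by simp [SignVec.comp, hX.2 e he, hY.2 e he]⟩
  elimination := by
    rintro X ⟨hX, hXA⟩ Y ⟨hY, hYA⟩ e he
    obtain ⟨Z, hZ, hZe, hZf⟩ := M.elimination X hX Y hY e he
    refine ⟨Z, ⟨hZ, fun f hf => ?_⟩, hZe, hZf⟩
    rw [hZf f (fun h => h.1 (hXA f hf))]
    simp [SignVec.comp, hXA f hf, hYA f hf]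

/-! ### Properties of the underlying matroid -/

/-- The underlying matroid is connected: any two distinct elements lie in a common circuit. -/
def Connected (M : OrientedMatroid α) : Prop :=
  ∀ e ∈ M.E, ∀ f ∈ M.E, e ≠ f → ∃ C, M.IsCircuit C ∧ C e ≠ 0 ∧ C f ≠ 0

/-- The underlying matroid is a loop: it has a unique element, and this element is a loop. -/
def IsLoop (M : OrientedMatroid α) : Prop :=
  ∃ e, M.E = {e} ∧ ∃ C, M.IsCircuit C ∧ Function.support C = {e}

/-- The underlying matroid is an isthmus: it has a unique element, and this element is an
isthmus (coloop). -/
def IsIsthmus (M : OrientedMatroid α) : Prop :=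
  ∃ e, M.E = {e} ∧ ∃ D, M.IsCocircuit D ∧ Function.support D = {e}

/-! ### Acyclic, totally cyclic, bounded and dual-bounded oriented matroids -/

/-- There is no positive circuit. -/
def Acyclic (M : OrientedMatroid α) : Prop :=
  ∀ C, ¬ M.IsPosCircuit C

/-- Every element belongs to a positive circuit. -/
def TotallyCyclic (M : OrientedMatroid α) : Prop :=
  ∀ e ∈ M.E, ∃ C, M.IsPosCircuit C ∧ e ∈ C

/-- `M` is bounded with respect to the element `p`. -/
def Bounded (M : OrientedMatroid α) (p : α) : Prop :=
  p ∈ M.E ∧ M.Acyclic ∧ ∀ D, M.IsPosCocircuit D → p ∈ D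

/-- `M` is dual-bounded with respect to the element `p`. -/
def DualBounded (M : OrientedMatroid α) (p : α) : Prop :=
  p ∈ M.E ∧ M.TotallyCyclic ∧ ∀ C, M.IsPosCircuit C → p ∈ C

end OrientedMatroid

/-! ### Filtrations -/

/-- A sequence of sets `(F'_ε, …, F'_0, F_c, F_0, …, F_ι)`. -/
@[ext]
structure FiltrationSeq (α : Type*) where
  ι : ℕ
  ε : ℕ
  F : Fin (ι + 1) → Set α
  Fc : Set α
  F' : Fin (ε + 1) → Set α

/-- The sequence `S` is a filtration of the set `E`: one has
`∅ = F'_ε ⊂ ⋯ ⊂ F'_0 = F_c = F_0 ⊂ ⋯ ⊂ F_ι = E` with strict inclusions, and the sequences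
`min (F_k \ F_{k-1})`, `1 ≤ k ≤ ι`, and `min (F'_{k-1} \ F'_k)`, `1 ≤ k ≤ ε`, are increasing
with `k`. An index `k : Fin ι` of the code stands for `k + 1` in these formulas. -/
structure FiltrationSeq.IsFiltration {α : Type*} [LinearOrder α]
    (S : FiltrationSeq α) (E : Set α) : Prop where
  bot : S.F' (Fin.last S.ε) = ∅
  strictAnti : StrictAnti S.F'
  F'_zero : S.F' 0 = S.Fc
  F_zero : S.F 0 = S.Fc
  strictMono : StrictMono S.F
  top : S.F (Fin.last S.ι) = E
  min_F : ∃ a : Fin S.ι → α, StrictMono a ∧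
    ∀ k, IsLeast (S.F k.succ \ S.F k.castSucc) (a k)
  min_F' : ∃ a' : Fin S.ε → α, StrictMono a' ∧
    ∀ k, IsLeast (S.F' k.castSucc \ S.F' k.succ) (a' k)

namespace OrientedMatroid

variable {α : Type*}

/-- `S` is a connected filtration of (the matroid underlying) `M`. -/
structure IsConnectedFiltration [LinearOrder α] (M : OrientedMatroid α)
    (S : FiltrationSeq α) : Prop where
  isFiltration : S.IsFiltration M.E
  connected_F : ∀ k : Fin S.ι,
    ((M.restrict (S.F k.succ)).contract (S.F k.castSucc)).Connected ∧
      ¬ ((M.restrict (S.F k.succ)).contract (S.F k.castSucc)).IsLoop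
  connected_F' : ∀ k : Fin S.ε,
    ((M.restrict (S.F' k.castSucc)).contract (S.F' k.succ)).Connected ∧
      ¬ ((M.restrict (S.F' k.castSucc)).contract (S.F' k.succ)).IsIsthmus

/-- The minors `M(F_k)/F_{k-1}` are bounded with respect to `min (F_k \ F_{k-1})`, and the
minors `M(F'_{k-1})/F'_k` are dual-bounded with respect to `min (F'_{k-1} \ F'_k)`. -/
structure HasBoundedMinors [LinearOrder α] (M : OrientedMatroid α)
    (S : FiltrationSeq α) : Prop where
  bounded : ∀ k : Fin S.ι, ∃ a, IsLeast (S.F k.succ \ S.F k.castSucc) a ∧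
    ((M.restrict (S.F k.succ)).contract (S.F k.castSucc)).Bounded a
  dualBounded : ∀ k : Fin S.ε, ∃ a', IsLeast (S.F' k.castSucc \ S.F' k.succ) a' ∧
    ((M.restrict (S.F' k.castSucc)).contract (S.F' k.succ)).DualBounded a'

/-! ### The active filtration -/

/-- `O*(M)`: the dual-active elements, smallest elements of positive cocircuits. -/
def dualActive [LinearOrder α] (M : OrientedMatroid α) : Set α :=
  {a | ∃ D, M.IsPosCocircuit D ∧ IsLeast D a}

/-- `O(M)`: the active elements, smallest elements of positive circuits. -/
def active [LinearOrder α] (M : OrientedMatroid α) : Set α :=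
  {a | ∃ C, M.IsPosCircuit C ∧ IsLeast C a}

theorem dualActive_finite [LinearOrder α] (M : OrientedMatroid α) : M.dualActive.Finite := by
  refine M.finite_ground.subset ?_
  rintro a ⟨_, ⟨X, hX, -, rfl⟩, ha⟩
  exact M.support_subset X hX.1 ha.1

theorem active_finite [LinearOrder α] (M : OrientedMatroid α) : M.active.Finite := by
  refine M.finite_ground.subset ?_
  rintro a ⟨_, ⟨X, hX, -, rfl⟩, ha⟩
  exact hX.1.1 ha.1

/-- The active filtration. With the dual-active elements `a_1 < ⋯ < a_ι` and the active elements
`a'_1 < ⋯ < a'_ε`, for `0 ≤ k < ι` the set `F_k` is the complement of the union of the positive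
cocircuits with smallest element `≥ a_{k+1}`, and for `0 ≤ k < ε` the set `F'_k` is the union of
the positive circuits with smallest element `≥ a'_{k+1}`; moreover `F_ι = E`, `F'_ε = ∅`, and
`F_c` is the union of all positive circuits. The enumerations `orderEmbOfFin` start at index `0`,
so that `a_{k+1}` is the value at `k`. -/
noncomputable def activeFiltration [LinearOrder α] (M : OrientedMatroid α) :
    FiltrationSeq α where
  ι := M.dualActive_finite.toFinset.card
  ε := M.active_finite.toFinset.card
  F := Fin.snoc (α := fun _ => Set α)
    (fun k => M.E \ ⋃₀ {D | M.IsPosCocircuit D ∧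
      ∃ m, IsLeast D m ∧ M.dualActive_finite.toFinset.orderEmbOfFin rfl k ≤ m})
    M.E
  Fc := ⋃₀ {C | M.IsPosCircuit C}
  F' := Fin.snoc (α := fun _ => Set α)
    (fun k => ⋃₀ {C | M.IsPosCircuit C ∧
      ∃ m, IsLeast C m ∧ M.active_finite.toFinset.orderEmbOfFin rfl k ≤ m})
    ∅

end OrientedMatroid

/-!
The supports of the nonnegative covectors of `M` form a union-closed family `𝒰`. If `E \ F_k ∈ 𝒰`,
then `M(F_k)/F_{k-1}` is bounded with respect to `p ∈ F_k \ F_{k-1}` exactly when `E \ F_{k-1} ∈ 𝒰`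
and every member of `𝒰` strictly containing `E \ F_k` and contained in `E \ F_{k-1}` contains `p`.
For the first half of a filtration, boundedness of the minors is therefore a condition on the chain
`E \ F_0 ⊃ ⋯ ⊃ E \ F_ι = ∅` in `𝒰`. As the minima `a_k` of the successive differences increase,
adding a member `V` of `𝒰` to the largest `E \ F_k` not containing it shows that the minimum of `V`
is `a_k`; hence the `a_k` are the dual-active elements, and `E \ F_{k-1}` is the union of the
members of `𝒰` with minimum at least `a_k`. The second half is the same statement for the dual of
`M`, and the two halves meet because a positive vector and a positive covector have disjoint
supports. Finally, in a bounded minor every element shares a positive cocircuit with `p`, so the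
dual matroid is connected, and connectivity is self-dual.
-/

namespace SignVec

variable {α : Type*} {X Y Z : α → SignType} {T : Set α} {e : α}

theorem comp_apply_of_ne_zero (h : X e ≠ 0) : comp X Y e = X e :=
  if_neg h

theorem comp_apply_of_eq_zero (h : X e = 0) : comp X Y e = Y e :=
  if_pos h

theorem support_comp (X Y : α → SignType) :
    Function.support (comp X Y) = Function.support X ∪ Function.support Y := by
  ext e
  by_cases h : X e = 0 <;> simp [comp, h]

theorem support_neg (X : α → SignType) : Function.support (-X) = Function.support X := by
  ext e
  simp

theorem comp_nonneg (hX : 0 ≤ X) (hY : 0 ≤ Y) : 0 ≤ comp X Y := fun e => by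
  unfold comp
  split_ifs
  exacts [hY e, hX e]

theorem notMem_sep : e ∉ sep X Y ↔ 0 ≤ X e * Y e := by
  have sign_fact : ∀ x y : SignType, ¬(x ≠ 0 ∧ x = -y) ↔ 0 ≤ x * y := by decide
  exact sign_fact _ _

theorem eq_of_notMem_sep (he : e ∉ sep Y X) (hY : Y e ≠ 0) (hX : X e ≠ 0) : Y e = X e := by
  have sign_fact : ∀ y x : SignType, 0 ≤ y * x → y ≠ 0 → x ≠ 0 → y = x := by decide
  exact sign_fact _ _ (notMem_sep.1 he) hY hX

theorem mem_sep_or_mem_sep_neg (hY : Y e ≠ 0) (hX : X e ≠ 0) :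
    e ∈ sep Y X ∨ e ∈ sep (-Y) X := by
  have sign_fact : ∀ y x : SignType, y ≠ 0 → x ≠ 0 →
      (y ≠ 0 ∧ y = -x) ∨ (-y ≠ 0 ∧ -y = -x) := by decide
  exact sign_fact _ _ hY hX

theorem Orthogonal.symm (h : Orthogonal X Y) : Orthogonal Y X := by
  simpa only [Orthogonal, mul_comm] using h

theorem Orthogonal.neg_left (h : Orthogonal X Y) : Orthogonal (-X) Y :=
  h.imp (fun h e => by simp [h e]) fun ⟨⟨e, he⟩, f, hf⟩ =>
    ⟨⟨f, by simp [hf]⟩, e, by simp [he]⟩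

theorem Orthogonal.mul_eq_zero_of_nonneg (h : Orthogonal X Y) (hn : 0 ≤ X * Y) (e : α) :
    X e * Y e = 0 := by
  rcases h with h | ⟨-, f, hf⟩
  · exact h e
  · exact absurd (hf ▸ hn f : (0 : SignType) ≤ -1) (by decide)

theorem exists_of_not_orthogonal (h : ¬ Orthogonal X Y) :
    (∃ e, X e * Y e ≠ 0) ∧ (0 ≤ X * Y ∨ 0 ≤ X * -Y) := by
  have nonneg_neg : ∀ s : SignType, s ≠ 1 → 0 ≤ -s := by decide
  have nonneg : ∀ s : SignType, s ≠ -1 → 0 ≤ s := by decide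
  simp only [Orthogonal, not_or, not_forall, not_and_or, not_exists] at h
  refine ⟨h.1, h.2.symm.imp (fun h f => nonneg _ (h f)) fun h f => ?_⟩
  simpa using nonneg_neg _ (h f)

theorem Orthogonal.comp_left (hX : Orthogonal X Z) (hY : Orthogonal Y Z) :
    Orthogonal (comp X Y) Z := by
  have comp_mul : ∀ e, X e * Z e ≠ 0 → comp X Y e * Z e = X e * Z e := fun e he => by
    rw [comp_apply_of_ne_zero (left_ne_zero_of_mul he)]
  rcases hX with hX | ⟨⟨e, he⟩, f, hf⟩
  · have comp_mul' : ∀ e, comp X Y e * Z e = Y e * Z e := fun e => by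
      rcases mul_eq_zero.1 (hX e) with h | h
      · rw [comp_apply_of_eq_zero h]
      · simp only [h, mul_zero]
    simpa only [Orthogonal, comp_mul'] using hY
  · exact Or.inr ⟨⟨e, by rw [comp_mul e (by simp [he]), he]⟩,
      f, by rw [comp_mul f (by simp [hf]), hf]⟩

theorem eqOn_comp (hX : Set.EqOn X Z (T ∩ Function.support X))
    (hY : Set.EqOn Y Z (T ∩ Function.support Y)) :
    Set.EqOn (comp X Y) Z (T ∩ Function.support (comp X Y)) := by
  rintro e ⟨heT, he⟩
  by_cases h : X e = 0
  · rw [Function.mem_support, comp_apply_of_eq_zero h] at he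
    rw [comp_apply_of_eq_zero h, hY ⟨heT, he⟩]
  · rw [comp_apply_of_ne_zero h, hX ⟨heT, h⟩]

theorem exists_eqOn_of_comp_mem {S : Set (α → SignType)} (h0 : 0 ∈ S)
    (hcomp : ∀ X ∈ S, ∀ Y ∈ S, comp X Y ∈ S) (hX : (T ∩ Function.support X).Finite)
    (h : ∀ e ∈ T ∩ Function.support X,
      ∃ Y ∈ S, Y e ≠ 0 ∧ Set.EqOn Y X (T ∩ Function.support Y)) :
    ∃ Y ∈ S, Set.EqOn Y X T := by
  suffices ∃ Y ∈ S, Set.EqOn Y X (T ∩ Function.support Y) ∧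
      T ∩ Function.support X ⊆ Function.support Y by
    obtain ⟨Y, hY, hYX, hXY⟩ := this
    refine ⟨Y, hY, fun f hf => ?_⟩
    by_cases h : Y f = 0
    · rw [h, eq_comm]
      by_contra hXf
      exact hXY ⟨hf, hXf⟩ h
    · exact hYX ⟨hf, h⟩
  refine Set.Finite.induction_on_subset _ hX ⟨0, h0, by simp, Set.empty_subset _⟩ ?_
  rintro e A he - - ⟨Y, hY, hYX, hA⟩
  obtain ⟨Z, hZ, hZe, hZX⟩ := h e he
  refine ⟨comp Y Z, hcomp Y hY Z hZ, eqOn_comp hYX hZX, ?_⟩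
  rw [support_comp]
  exact Set.insert_subset (Or.inr hZe) (hA.trans Set.subset_union_left)

/-- The colour constraint of the painting lemma at the element `f`: `X f` is zero or equal to
`P f` if `P f ≠ 0`, and `X f` vanishes if `P f = 0` and `f ∈ W`. A vector is meant to respect
`(P, Wᶜ)` when a covector respects `(P, W)`. -/
def RespectsAt (P : α → SignType) (W : Set α) (X : α → SignType) (f : α) : Prop :=
  0 ≤ X f * P f ∧ (P f = 0 → f ∈ W → X f = 0)

variable {P V : α → SignType} {W : Set α}

theorem respectsAt_of_eq_zero (h : X e = 0) : RespectsAt P W X e :=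
  ⟨by simp [h], fun _ _ => h⟩

theorem RespectsAt.congr (hX : RespectsAt P W X e) (h : Y e = X e) : RespectsAt P W Y e := by
  rwa [RespectsAt, h]

theorem RespectsAt.eq_of_ne_zero (h : RespectsAt P W X e) (he : P e = 0 → e ∈ W) (hX : X e ≠ 0) :
    X e = P e := by
  have hP : P e ≠ 0 := fun h0 => hX (h.2 h0 (he h0))
  have sign_fact : ∀ x p : SignType, x ≠ 0 → p ≠ 0 → 0 ≤ x * p → x = p := by decide
  exact sign_fact _ _ hX hP h.1

theorem RespectsAt.mul_nonneg (hV : RespectsAt P Wᶜ V e) (hX : RespectsAt P W X e) :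
    0 ≤ V e * X e := by
  by_cases hP : P e = 0
  · by_cases he : e ∈ W
    · simp [hX.2 hP he]
    · simp [hV.2 hP he]
  · have sign_fact : ∀ p v x : SignType, p ≠ 0 → 0 ≤ v * p → 0 ≤ x * p → 0 ≤ v * x := by decide
    exact sign_fact _ _ _ hP hV.1 hX.1

theorem mul_nonneg_of_not_respectsAt (hV : ¬ RespectsAt P Wᶜ V e) (hX : ¬ RespectsAt P W X e) :
    0 ≤ V e * X e := by
  by_cases hP : P e = 0
  · simp only [RespectsAt, hP, mul_zero, le_refl, true_and, forall_const, Classical.not_imp]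
      at hV hX
    exact absurd hX.1 hV.1
  · simp only [RespectsAt, hP, false_imp_iff, and_true] at hV hX
    have sign_fact : ∀ p v x : SignType, ¬ 0 ≤ v * p → ¬ 0 ≤ x * p → 0 ≤ v * x := by decide
    exact sign_fact _ _ _ hV hX

end SignVec

namespace OrientedMatroid

open SignVec

variable {α : Type*} {M : OrientedMatroid α} {e f g : α}

section SignVectors

variable {U V X Y Z : α → SignType}

theorem mul_eq_zero_of_mem_vectors (hV : V ∈ M.vectors) (hX : X ∈ M.covectors) (hn : 0 ≤ V * X)
    (e : α) : V e * X e = 0 :=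
  (hV.2 X hX).mul_eq_zero_of_nonneg hn e

theorem exists_mul_nonneg_of_notMem_vectors (hsupp : Function.support V ⊆ M.E)
    (hV : V ∉ M.vectors) : ∃ X ∈ M.covectors, 0 ≤ V * X ∧ ∃ e, V e * X e ≠ 0 := by
  simp only [vectors, Set.mem_ofPred_eq, hsupp, true_and, not_forall] at hV
  obtain ⟨X, hX, hVX⟩ := hV
  obtain ⟨⟨e, he⟩, h | h⟩ := exists_of_not_orthogonal hVX
  · exact ⟨X, hX, h, e, he⟩
  · exact ⟨-X, M.neg_mem X hX, h, e, by simpa using he⟩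

theorem elimination_mul_nonneg (hX : X ∈ M.covectors) (hY : Y ∈ M.covectors)
    (he : e ∈ sep X Y) (hVX : 0 ≤ V * X) (hVY : 0 ≤ V * Y) :
    ∃ Z ∈ M.covectors, Z e = 0 ∧ 0 ≤ V * Z ∧ ∀ f, V f * Z f = 0 → V f * X f = 0 := by
  obtain ⟨Z, hZ, hZe, hZf⟩ := M.elimination X hX Y hY e he
  have key : ∀ f, 0 ≤ V f * Z f ∧ (V f * Z f = 0 → V f * X f = 0) := by
    intro f
    by_cases hf : f ∈ sep X Y
    · have sign_fact : ∀ v x y : SignType,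
          0 ≤ v * x → 0 ≤ v * y → x ≠ 0 → x = -y → v = 0 := by decide
      simp [sign_fact _ _ _ (hVX f) (hVY f) hf.1 hf.2]
    · rw [hZf f hf]
      by_cases h0 : X f = 0
      · rw [comp_apply_of_eq_zero h0]
        exact ⟨hVY f, by simp [h0]⟩
      · rw [comp_apply_of_ne_zero h0]
        exact ⟨hVX f, id⟩
  exact ⟨Z, hZ, hZe, fun f => (key f).1, fun f => (key f).2⟩

theorem exists_mem_vectors_of_contract_singleton (hg : g ∈ M.E)
    (hV : V ∈ (M.contract {g}).vectors) :
    ∃ U ∈ M.vectors, ∀ f, f ≠ g → U f = V f := by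
  classical
  have hVg : V g = 0 := by
    by_contra h
    exact (hV.1 h).2 rfl
  have contract_mul_eq_zero : ∀ X ∈ M.covectors, X g = 0 → 0 ≤ V * X → ∀ f, V f * X f = 0 :=
    fun X hX hXg => mul_eq_zero_of_mem_vectors hV ⟨hX, by simpa using hXg⟩
  by_contra! hno
  -- Every choice of a sign at `g` is refuted by some covector.
  have refute : ∀ s, ∃ X ∈ M.covectors, X g ≠ 0 ∧ 0 ≤ s * X g ∧ 0 ≤ V * X ∧
      ∃ e, Function.update V g s e * X e ≠ 0 := by
    intro s
    have hsupp : Function.support (Function.update V g s) ⊆ M.E := fun e he => by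
      by_cases h : e = g
      · exact h ▸ hg
      · rw [Function.mem_support, Function.update_of_ne h] at he
        exact (hV.1 he).1
    obtain ⟨X, hX, hn, e, he⟩ := exists_mul_nonneg_of_notMem_vectors hsupp fun h => by
      obtain ⟨f, hf, hne⟩ := hno _ h
      exact hne (Function.update_of_ne hf _ _)
    have hn' : 0 ≤ V * X := fun f => by
      by_cases h : f = g
      · simp [h, hVg]
      · simpa [h] using hn f
    refine ⟨X, hX, fun hXg => he ?_, by simpa using hn g, hn', e, he⟩
    by_cases h : e = g
    · simp [h, hXg]
    · simpa [h] using contract_mul_eq_zero X hX hXg hn' e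
  obtain ⟨X, hX, hXg, -, hVX, e, he⟩ := refute 0
  obtain ⟨Y, hY, hYg, hXYg, hVY, -⟩ := refute (-X g)
  have hsep : g ∈ sep X Y := by
    have sign_fact : ∀ x y : SignType, y ≠ 0 → x ≠ 0 → 0 ≤ -x * y → x = -y := by decide
    exact ⟨hXg, sign_fact _ _ hYg hXg hXYg⟩
  obtain ⟨Z, hZ, hZg, hVZ, hZX⟩ := elimination_mul_nonneg hX hY hsep hVX hVY
  have heg : e ≠ g := fun h => he (by simp [h])
  rw [Function.update_of_ne heg] at he
  exact he (hZX e (contract_mul_eq_zero Z hZ hZg hVZ e))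

theorem mem_vectors_restrict {F : Set α} :
    V ∈ (M.restrict F).vectors ↔ V ∈ M.vectors ∧ Function.support V ⊆ F := by
  have mul_indicator : Function.support V ⊆ F → ∀ X : α → SignType, ∀ e,
      V e * F.indicator X e = V e * X e := fun hV X e => by
    by_cases he : V e = 0
    · simp [he]
    · rw [Set.indicator_of_mem (hV he)]
  constructor
  · rintro ⟨hsupp, hV⟩
    have hF := hsupp.trans Set.inter_subset_right
    refine ⟨⟨hsupp.trans Set.inter_subset_left, fun X hX => ?_⟩, hF⟩
    simpa only [Orthogonal, mul_indicator hF] using hV _ ⟨X, hX, rfl⟩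
  · rintro ⟨⟨hsupp, hV⟩, hF⟩
    refine ⟨Set.subset_inter hsupp hF, ?_⟩
    rintro _ ⟨X, hX, rfl⟩
    simpa only [Orthogonal, mul_indicator hF] using hV X hX

theorem exists_respectsAt_of_minors {P : α → SignType} {W : Set α} (hP : P e ≠ 0) (hg : g ∈ M.E)
    (hX : X ∈ (M.restrict {g}ᶜ).covectors) (hXe : X e = P e) (hXP : ∀ f, RespectsAt P W X f)
    (hV : V ∈ (M.contract {g}).vectors) (hVe : V e = P e) (hVP : ∀ f, RespectsAt P Wᶜ V f) :
    (∃ X ∈ M.covectors, X e = P e ∧ ∀ f, RespectsAt P W X f) ∨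
      ∃ V ∈ M.vectors, V e = P e ∧ ∀ f, RespectsAt P Wᶜ V f := by
  have heg : e ≠ g := by
    rintro rfl
    exact (hV.1 (hVe.trans_ne hP)).2 rfl
  obtain ⟨X, hX, rfl⟩ := hX
  obtain ⟨U, hU, hUV⟩ := exists_mem_vectors_of_contract_singleton hg hV
  have hXeq : ∀ f, f ≠ g → X f = ({g}ᶜ : Set α).indicator X f := fun f hf =>
    (Set.indicator_of_mem hf _).symm
  have hXP' : ∀ f, f ≠ g → RespectsAt P W X f := fun f hf => (hXP f).congr (hXeq f hf)
  have hUP' : ∀ f, f ≠ g → RespectsAt P Wᶜ U f := fun f hf => (hVP f).congr (hUV f hf)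
  have hXe' : X e = P e := (hXeq e heg).trans hXe
  have hUe' : U e = P e := (hUV e heg).trans hVe
  by_cases hXg : RespectsAt P W X g
  · exact Or.inl ⟨X, hX, hXe', fun f => (eq_or_ne f g).elim (fun h => h ▸ hXg) (hXP' f)⟩
  by_cases hUg : RespectsAt P Wᶜ U g
  · exact Or.inr ⟨U, hU, hUe', fun f => (eq_or_ne f g).elim (fun h => h ▸ hUg) (hUP' f)⟩
  have hUX : 0 ≤ U * X := fun f => by
    by_cases hf : f = g
    · exact hf ▸ mul_nonneg_of_not_respectsAt hUg hXg
    · exact (hUP' f hf).mul_nonneg (hXP' f hf)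
  have := mul_eq_zero_of_mem_vectors hU hX hUX e
  simp [hXe', hUe', hP] at this

theorem exists_respectsAt_of_ground_eq_singleton {P : α → SignType} {W : Set α} (hE : M.E = {e})
    (hP : P e ≠ 0) :
    (∃ X ∈ M.covectors, X e = P e ∧ ∀ f, RespectsAt P W X f) ∨
      ∃ V ∈ M.vectors, V e = P e ∧ ∀ f, RespectsAt P Wᶜ V f := by
  classical
  have respectsAt_of_supp : ∀ {W X}, Function.support X ⊆ M.E → X e = P e →
      ∀ f, RespectsAt P W X f := fun {W X} hX hXe f => by
    by_cases hf : f = e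
    · subst hf
      have sign_fact : ∀ p : SignType, 0 ≤ p * p := by decide
      exact ⟨hXe ▸ sign_fact _, fun h => absurd h hP⟩
    · exact respectsAt_of_eq_zero (Function.notMem_support.1 fun h => hf (hE ▸ hX h : f ∈ {e}))
  by_cases hX : ∃ X ∈ M.covectors, X e ≠ 0
  · obtain ⟨X, hX, hXe⟩ := hX
    have sign_fact : ∀ x p : SignType, x ≠ 0 → p ≠ 0 → x = p ∨ -x = p := by decide
    obtain ⟨Y, hY, hYe⟩ : ∃ Y ∈ M.covectors, Y e = P e :=
      (sign_fact _ _ hXe hP).elim (fun h => ⟨X, hX, h⟩) fun h => ⟨-X, M.neg_mem X hX, h⟩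
    exact Or.inl ⟨Y, hY, hYe, respectsAt_of_supp (M.support_subset Y hY) hYe⟩
  · push Not at hX
    have hsupp : Function.support (Pi.single e (P e)) ⊆ M.E :=
      hE ▸ Pi.support_single_subset
    refine Or.inr ⟨Pi.single e (P e), ⟨hsupp, fun X hXM => Or.inl fun f => ?_⟩,
      Pi.single_eq_same _ _, respectsAt_of_supp hsupp (Pi.single_eq_same _ _)⟩
    by_cases hf : f = e
    · simp [hf, hX X hXM]
    · simp [hf]

theorem painting (he : e ∈ M.E) {P : α → SignType} (hP : P e ≠ 0) (W : Set α) :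
    (∃ X ∈ M.covectors, X e = P e ∧ ∀ f, RespectsAt P W X f) ∨
      ∃ V ∈ M.vectors, V e = P e ∧ ∀ f, RespectsAt P Wᶜ V f := by
  induction hn : M.E.ncard using Nat.strong_induction_on generalizing M with
  | _ n ih =>
    subst hn
    by_cases hE : M.E = {e}
    · exact exists_respectsAt_of_ground_eq_singleton hE hP
    obtain ⟨g, hg, hge⟩ : ∃ g ∈ M.E, g ≠ e := by
      by_contra! h
      exact hE (Set.eq_singleton_iff_unique_mem.2 ⟨he, h⟩)
    have hlt : (M.E \ {g}).ncard < M.E.ncard :=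
      Set.ncard_sdiff_singleton_lt_of_mem hg M.finite_ground
    rcases ih _ hlt (M := M.restrict {g}ᶜ) ⟨he, hge.symm⟩ rfl with ⟨X, hX, hXe, hXP⟩ | ⟨V, hV, h⟩
    · rcases ih _ hlt (M := M.contract {g}) ⟨he, hge.symm⟩ rfl with
        ⟨Y, hY, h⟩ | ⟨V, hV, hVe, hVP⟩
      · exact Or.inl ⟨Y, hY.1, h⟩
      · exact exists_respectsAt_of_minors hP hg hX hXe hXP hV hVe hVP
    · exact Or.inr ⟨V, (mem_vectors_restrict.1 hV).1, h⟩

theorem covector_apply_eq_zero (hX : X ∈ M.covectors) (he : e ∉ M.E) : X e = 0 :=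
  Function.notMem_support.1 fun h => he (M.support_subset X hX h)

theorem mem_covectors_of_forall_orthogonal (hX : Function.support X ⊆ M.E)
    (h : ∀ V ∈ M.vectors, Orthogonal X V) : X ∈ M.covectors := by
  obtain ⟨Y, hY, hYX⟩ := exists_eqOn_of_comp_mem (X := X) (T := Set.univ) M.zero_mem M.comp_mem
    (M.finite_ground.subset (Set.inter_subset_right.trans hX)) fun e ⟨_, he⟩ => by
      rcases painting (hX he) he Set.univ with ⟨Y, hY, hYe, hYX⟩ | ⟨V, hV, hVe, hVX⟩
      · exact ⟨Y, hY, hYe ▸ he, fun f hf => (hYX f).eq_of_ne_zero (fun _ => trivial) hf.2⟩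
      · have := (h V hV).symm.mul_eq_zero_of_nonneg (fun f => (hVX f).1) e
        exact absurd (by simpa [hVe] using this) he
  rwa [← (Set.eqOn_univ Y X).1 hYX]

theorem zero_mem_vectors (M : OrientedMatroid α) : 0 ∈ M.vectors :=
  ⟨by simp, fun _ _ => Or.inl (by simp)⟩

theorem neg_mem_vectors (hV : V ∈ M.vectors) : -V ∈ M.vectors :=
  ⟨(support_neg V).trans_subset hV.1, fun X hX => (hV.2 X hX).neg_left⟩

theorem comp_mem_vectors (hU : U ∈ M.vectors) (hV : V ∈ M.vectors) : comp U V ∈ M.vectors :=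
  ⟨(support_comp U V).trans_subset (Set.union_subset hU.1 hV.1),
    fun X hX => (hU.2 X hX).comp_left (hV.2 X hX)⟩

theorem comp_apply_eq_zero_of_mem_sep (hU : U ∈ M.vectors) (hV : V ∈ M.vectors)
    (he : e ∈ sep U V) (hX : X ∈ M.covectors) (hsep : ∀ g ∈ sep U V, g ≠ e → X g = 0)
    (hn : ∀ g ∉ sep U V, 0 ≤ X g * comp U V g) (hXf : X f ≠ 0) :
    comp U V f = 0 := by
  have sign_fact : ∀ x u v : SignType, 0 ≤ x * (if u = 0 then v else u) → 0 ≤ u * v →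
      0 ≤ u * x ∧ 0 ≤ v * x := by decide
  have mul_nonneg : ∀ g, g ≠ e → 0 ≤ U g * X g ∧ 0 ≤ V g * X g := fun g hge => by
    by_cases hg : g ∈ sep U V
    · simp [hsep g hg hge]
    · exact sign_fact _ _ _ (hn g hg) (notMem_sep.1 hg)
  have eq_zero_of_nonneg : ∀ {Z}, Z ∈ M.vectors → Z e ≠ 0 → (∀ g, g ≠ e → 0 ≤ Z g * X g) →
      0 ≤ Z e * X e → X e = 0 ∧ Z f = 0 := fun {Z} hZ hZe hZn hZX => by
    have h0 := mul_eq_zero_of_mem_vectors hZ hX fun g => by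
      rcases eq_or_ne g e with rfl | hg
      exacts [hZX, hZn g hg]
    exact ⟨(mul_eq_zero.1 (h0 e)).resolve_left hZe, (mul_eq_zero.1 (h0 f)).resolve_right hXf⟩
  have hU0 := eq_zero_of_nonneg hU he.1 fun g hg => (mul_nonneg g hg).1
  have hV0 := eq_zero_of_nonneg hV (fun h => he.1 (by rw [he.2, h, neg_zero]))
    fun g hg => (mul_nonneg g hg).2
  have hXe : X e = 0 := by
    have sign_fact : ∀ u v x : SignType, u = -v → 0 ≤ u * x ∨ 0 ≤ v * x := by decide
    rcases sign_fact _ _ (X e) he.2 with h | h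
    exacts [(hU0 h).1, (hV0 h).1]
  rw [comp_apply_of_eq_zero (hU0 (by simp [hXe])).2, (hV0 (by simp [hXe])).2]

theorem vector_elimination (hU : U ∈ M.vectors) (hV : V ∈ M.vectors) (he : e ∈ sep U V) :
    ∃ Z ∈ M.vectors, Z e = 0 ∧ ∀ f ∉ sep U V, Z f = comp U V f := by
  classical
  have hUV := comp_mem_vectors hU hV
  obtain ⟨Z, ⟨hZ, hZe⟩, hZf⟩ := exists_eqOn_of_comp_mem (S := {Z | Z ∈ M.vectors ∧ Z e = 0})
    (X := comp U V) (T := (sep U V)ᶜ) ⟨M.zero_mem_vectors, rfl⟩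
    (fun X hX Y hY => ⟨comp_mem_vectors hX.1 hY.1, (comp_apply_of_eq_zero hX.2).trans hY.2⟩)
    (M.finite_ground.subset (Set.inter_subset_right.trans hUV.1)) fun f ⟨hf, hUVf⟩ => by
      set P : α → SignType := (sep U V)ᶜ.indicator (comp U V)
      have hP : ∀ g ∉ sep U V, P g = comp U V g := fun g hg => Set.indicator_of_mem hg _
      have hP' : ∀ g ∈ sep U V, P g = 0 := fun g hg => Set.indicator_of_notMem (by simpa) _
      rcases painting (hUV.1 hUVf) (P := P) (by rwa [hP f hf]) (sep U V \ {e}) with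
        ⟨X, hX, hXf, hXP⟩ | ⟨Z, hZ, hZf, hZP⟩
      · refine absurd (comp_apply_eq_zero_of_mem_sep hU hV he hX ?_ ?_ ?_) hUVf
        · exact fun g hg hge => (hXP g).2 (hP' g hg) ⟨hg, hge⟩
        · exact fun g hg => hP g hg ▸ (hXP g).1
        · rwa [hXf, hP f hf]
      · refine ⟨Z, ⟨hZ, (hZP e).2 (hP' e he) (by simp)⟩, by rwa [hZf, hP f hf], fun g hg => ?_⟩
        rw [(hZP g).eq_of_ne_zero (fun _ h => hg.1 h.1) hg.2, hP g hg.1]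
  exact ⟨Z, hZ, hZe, hZf⟩

/-- The dual oriented matroid, whose covectors are the vectors. -/
def dual (M : OrientedMatroid α) : OrientedMatroid α where
  E := M.E
  finite_ground := M.finite_ground
  covectors := M.vectors
  support_subset := fun _ hV => hV.1
  zero_mem := M.zero_mem_vectors
  neg_mem := fun _ hV => neg_mem_vectors hV
  comp_mem := fun _ hU _ hV => comp_mem_vectors hU hV
  elimination := fun _ hU _ hV _ he => vector_elimination hU hV he

theorem ext_covectors {M N : OrientedMatroid α} (hE : M.E = N.E)
    (hc : M.covectors = N.covectors) : M = N := by
  cases M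
  cases N
  congr

theorem vectors_dual (M : OrientedMatroid α) : M.dual.vectors = M.covectors :=
  Set.Subset.antisymm (fun _ hX => mem_covectors_of_forall_orthogonal hX.1 hX.2)
    fun X hX => ⟨M.support_subset X hX, fun _ hV => (hV.2 X hX).symm⟩

theorem dual_dual (M : OrientedMatroid α) : M.dual.dual = M :=
  ext_covectors rfl M.vectors_dual

theorem isCircuit_dual : M.dual.IsCircuit X ↔ M.IsCocircuit X := by
  rw [IsCircuit, vectors_dual, IsCocircuit]

theorem dual_restrict (M : OrientedMatroid α) (F : Set α) :
    (M.restrict F).dual = M.dual.contract Fᶜ := by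
  refine ext_covectors (by simp [dual, restrict, contract]) (Set.ext fun _ => ?_)
  exact mem_vectors_restrict.trans (and_congr_right fun _ => Function.support_subset_iff')

theorem dual_contract (M : OrientedMatroid α) (F : Set α) :
    (M.contract F).dual = M.dual.restrict Fᶜ := by
  rw [← dual_dual (M.dual.restrict Fᶜ), dual_restrict, dual_dual, compl_compl]

theorem contract_restrict {F G : Set α} (h : F ⊆ G) :
    (M.contract F).restrict G = (M.restrict G).contract F := by
  refine ext_covectors (Set.sdiff_inter_right_comm ..) ?_
  ext X
  constructor
  · rintro ⟨Y, ⟨hY, hYF⟩, rfl⟩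
    exact ⟨⟨Y, hY, rfl⟩, fun e he => by simp [hYF e he]⟩
  · rintro ⟨⟨Y, hY, rfl⟩, h0⟩
    exact ⟨Y, ⟨hY, fun e he => by simpa [h he] using h0 e he⟩, rfl⟩

theorem dual_minor {F G : Set α} (h : F ⊆ G) :
    ((M.restrict G).contract F).dual = (M.dual.restrict Fᶜ).contract Gᶜ := by
  rw [dual_contract, dual_restrict, contract_restrict (Set.compl_subset_compl.2 h)]

theorem finite_support (hX : X ∈ M.covectors) : (Function.support X).Finite :=
  M.finite_ground.subset (M.support_subset X hX)

theorem exists_support_ssubset_of_mem_sep (hY : Y ∈ M.covectors) (hX : X ∈ M.covectors)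
    (hYX : Function.support Y ⊆ Function.support X) (hf : f ∈ sep Y X) :
    ∃ W ∈ M.covectors, Set.EqOn W X (sep Y X)ᶜ ∧ Function.support W ⊂ Function.support X ∧
      sep W X ⊂ sep Y X := by
  obtain ⟨W, hW, hWf, hWg⟩ := M.elimination Y hY X hX f hf
  have hWX : Set.EqOn W X (sep Y X)ᶜ := fun g hg => by
    rw [hWg g hg]
    by_cases h : Y g = 0
    · exact comp_apply_of_eq_zero h
    · rw [comp_apply_of_ne_zero h, eq_of_notMem_sep hg h (hYX h)]
  refine ⟨W, hW, hWX, ⟨fun g hg => ?_, fun h => h (hYX hf.1) hWf⟩, fun g hg => ?_,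
    fun h => (h hf).1 hWf⟩
  · by_cases hgs : g ∈ sep Y X
    · exact hYX hgs.1
    · rwa [Function.mem_support, hWX hgs] at hg
  · by_contra hgs
    have sign_fact : ∀ x : SignType, 0 ≤ x * x := by decide
    exact notMem_sep.2 (hWX hgs ▸ sign_fact _) hg

theorem exists_conformal_of_sep_nonempty (hY : Y ∈ M.covectors) (hX : X ∈ M.covectors)
    (hYX : Function.support Y ⊆ Function.support X) (hsep : (sep Y X).Nonempty) :
    ∃ W ∈ M.covectors, Set.EqOn W X (Function.support W) ∧ Set.EqOn W X (sep Y X)ᶜ ∧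
      Function.support W ⊂ Function.support X := by
  induction hn : (sep Y X).ncard using Nat.strong_induction_on generalizing Y with
  | _ n ih =>
    obtain ⟨f, hf⟩ := hsep
    obtain ⟨W, hW, hWX, hss, hlt⟩ := exists_support_ssubset_of_mem_sep hY hX hYX hf
    rcases (sep W X).eq_empty_or_nonempty with h | h
    · refine ⟨W, hW, fun g hg => eq_of_notMem_sep (h ▸ Set.notMem_empty g) hg (hss.1 hg), hWX, hss⟩
    · have hfin : (sep Y X).Finite := (finite_support hY).subset fun g hg => hg.1
      obtain ⟨V, hV, hVX, hVX', hVss⟩ := ih _ (hn ▸ Set.ncard_lt_ncard hlt hfin) hW hss.1 h rfl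
      exact ⟨V, hV, hVX, hVX'.mono (Set.compl_subset_compl.2 hlt.1), hVss⟩

theorem exists_conformal_of_support_ssubset (hY : Y ∈ M.covectors) (hX : X ∈ M.covectors)
    (hY0 : Y ≠ 0) (hYX : Function.support Y ⊂ Function.support X) (he : X e ≠ 0) :
    ∃ W ∈ M.covectors, W e = X e ∧ Set.EqOn W X (Function.support W) ∧
      Function.support W ⊂ Function.support X := by
  have of_notMem_sep : ∀ Z ∈ M.covectors, Function.support Z ⊂ Function.support X →
      e ∉ sep Z X → (sep Z X).Nonempty ∨ Z e = X e → ∃ W ∈ M.covectors, W e = X e ∧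
        Set.EqOn W X (Function.support W) ∧ Function.support W ⊂ Function.support X := by
    intro Z hZ hZX heZ h
    rcases (sep Z X).eq_empty_or_nonempty with h0 | hne
    · exact ⟨Z, hZ, h.resolve_left (by simp [h0]),
        fun g hg => eq_of_notMem_sep (h0 ▸ Set.notMem_empty g) hg (hZX.1 hg), hZX⟩
    · obtain ⟨W, hW, hWX, hWe, hss⟩ := exists_conformal_of_sep_nonempty hZ hX hZX.1 hne
      exact ⟨W, hW, hWe heZ, hWX, hss⟩
  have hnY := M.neg_mem Y hY
  have hnYX : Function.support (-Y) ⊂ Function.support X := by rwa [support_neg]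
  by_cases hYe : Y e = 0
  · obtain ⟨f, hf⟩ := Function.ne_iff.1 hY0
    rcases mem_sep_or_mem_sep_neg hf (hYX.1 hf) with h | h
    · exact of_notMem_sep Y hY hYX (fun h => h.1 hYe) (Or.inl ⟨f, h⟩)
    · exact of_notMem_sep (-Y) hnY hnYX (fun h => h.1 (by simp [hYe])) (Or.inl ⟨f, h⟩)
  · have sign_fact : ∀ y x : SignType, y ≠ 0 → x ≠ 0 → 0 ≤ y * x ∧ y = x ∨ 0 ≤ -y * x ∧ -y = x := by
      decide
    rcases sign_fact _ _ hYe he with ⟨h, h'⟩ | ⟨h, h'⟩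
    · exact of_notMem_sep Y hY hYX (notMem_sep.2 h) (Or.inr h')
    · exact of_notMem_sep (-Y) hnY hnYX (notMem_sep.2 h) (Or.inr h')

theorem exists_isCocircuit_conformal (hX : X ∈ M.covectors) (he : X e ≠ 0) :
    ∃ D, M.IsCocircuit D ∧ D e = X e ∧ Set.EqOn D X (Function.support D) := by
  induction hn : (Function.support X).ncard using Nat.strong_induction_on generalizing X with
  | _ n ih =>
    by_cases hmin : M.IsCocircuit X
    · exact ⟨X, hmin, rfl, Set.eqOn_refl _ _⟩
    have hX0 : X ≠ 0 := fun h => he (by simp [h])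
    simp only [IsCocircuit, IsMinSupport, hX, true_and, hX0, ne_eq, not_false_iff, not_forall]
      at hmin
    obtain ⟨Y, hY, hY0, hYX, hne⟩ := hmin
    obtain ⟨W, hW, hWe, hWX, hss⟩ :=
      exists_conformal_of_support_ssubset hY hX hY0 (hYX.ssubset_of_ne hne) he
    obtain ⟨D, hD, hDe, hDW⟩ :=
      ih _ (hn ▸ Set.ncard_lt_ncard hss (finite_support hX)) hW (hWe ▸ he) rfl
    refine ⟨D, hD, hDe.trans hWe, fun f hf => ?_⟩
    rw [hDW hf, hWX (Function.mem_support.2 (hDW hf ▸ hf))]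

theorem mem_covectors_of_forall_isCircuit (hX : Function.support X ⊆ M.E)
    (h : ∀ C, M.IsCircuit C → Orthogonal C X) : X ∈ M.covectors := by
  refine mem_covectors_of_forall_orthogonal hX fun V hV => ?_
  by_contra hno
  obtain ⟨V, hV, ⟨e, he⟩, hn⟩ : ∃ V ∈ M.vectors, (∃ e, X e * V e ≠ 0) ∧ 0 ≤ X * V := by
    obtain ⟨⟨e, he⟩, hn | hn⟩ := exists_of_not_orthogonal hno
    · exact ⟨V, hV, ⟨e, he⟩, hn⟩
    · exact ⟨-V, neg_mem_vectors hV, ⟨e, by simpa using he⟩, hn⟩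
  obtain ⟨C, hC, hCe, hCV⟩ :=
    exists_isCocircuit_conformal (M := M.dual) hV (right_ne_zero_of_mul he)
  refine he (hCe ▸ (h C hC).symm.mul_eq_zero_of_nonneg (fun f => ?_) e)
  by_cases hf : C f = 0
  · simp [hf]
  · simpa [hCV hf] using hn f

end SignVectors

section PositiveCovectors

variable {C D U V : Set α} {p : α}

/-- The supports of the nonnegative covectors. Identifying positive covectors with their supports,
these are the positive covectors of `M`, and `M.dual.posCovectors` are its positive vectors. -/
def posCovectors (M : OrientedMatroid α) : Set (Set α) :=
  {U | ∃ X ∈ M.covectors, 0 ≤ X ∧ Function.support X = U}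

theorem empty_mem_posCovectors (M : OrientedMatroid α) : ∅ ∈ M.posCovectors :=
  ⟨0, M.zero_mem, le_rfl, Function.support_zero⟩

theorem supClosed_posCovectors (M : OrientedMatroid α) : SupClosed M.posCovectors := by
  rintro _ ⟨X, hX, hX0, rfl⟩ _ ⟨Y, hY, hY0, rfl⟩
  exact ⟨comp X Y, M.comp_mem X hX Y hY, comp_nonneg hX0 hY0, support_comp X Y⟩

theorem subset_ground_of_mem_posCovectors (hU : U ∈ M.posCovectors) : U ⊆ M.E := by
  obtain ⟨X, hX, -, rfl⟩ := hU
  exact M.support_subset X hX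

theorem finite_sUnion_posCovectors (M : OrientedMatroid α) : (⋃₀ M.posCovectors).Finite :=
  M.finite_ground.subset (Set.sUnion_subset fun _ => subset_ground_of_mem_posCovectors)

theorem finite_posCovectors (M : OrientedMatroid α) : M.posCovectors.Finite :=
  M.finite_sUnion_posCovectors.finite_subsets.subset fun _ => Set.subset_sUnion_of_mem

theorem IsPosCocircuit.mem_posCovectors (hD : M.IsPosCocircuit D) : D ∈ M.posCovectors := by
  obtain ⟨X, hX, hX0, rfl⟩ := hD
  exact ⟨X, hX.1, hX0, rfl⟩

theorem IsPosCocircuit.nonempty (hD : M.IsPosCocircuit D) : D.Nonempty := by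
  obtain ⟨X, hX, -, rfl⟩ := hD
  exact Function.support_nonempty_iff.2 hX.2.1

theorem exists_isPosCocircuit_subset (hU : U ∈ M.posCovectors) (he : e ∈ U) :
    ∃ D, M.IsPosCocircuit D ∧ e ∈ D ∧ D ⊆ U := by
  obtain ⟨X, hX, hX0, rfl⟩ := hU
  obtain ⟨D, hD, hDe, hDX⟩ := exists_isCocircuit_conformal hX he
  refine ⟨_, ⟨D, hD, fun f => ?_, rfl⟩, hDe.trans_ne he, fun f hf => (hDX hf).symm.trans_ne hf⟩
  by_cases hf : D f = 0
  · exact hf.ge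
  · exact hDX hf ▸ hX0 f

theorem disjoint_of_mem_posCovectors_dual (hV : V ∈ M.dual.posCovectors)
    (hU : U ∈ M.posCovectors) : Disjoint V U := by
  obtain ⟨Y, hY, hY0, rfl⟩ := hV
  obtain ⟨X, hX, hX0, rfl⟩ := hU
  have sign_fact : ∀ y x : SignType, 0 ≤ y → 0 ≤ x → 0 ≤ y * x := by decide
  have h0 := mul_eq_zero_of_mem_vectors hY hX fun e => sign_fact _ _ (hY0 e) (hX0 e)
  exact Set.disjoint_left.2 fun e heY heX => mul_ne_zero heY heX (h0 e)

theorem mem_posCovectors_or_mem_dual (he : e ∈ M.E) :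
    (∃ U ∈ M.posCovectors, e ∈ U) ∨ ∃ V ∈ M.dual.posCovectors, e ∈ V := by
  refine (painting he (P := 1) one_ne_zero ∅).imp ?_ ?_ <;>
  · rintro ⟨X, hX, hXe, hX1⟩
    exact ⟨_, ⟨X, hX, fun f => by simpa using (hX1 f).1, rfl⟩, by simp [hXe]⟩

theorem sUnion_dual_posCovectors (M : OrientedMatroid α) :
    ⋃₀ M.dual.posCovectors = M.E \ ⋃₀ M.posCovectors := by
  ext e
  constructor
  · rintro ⟨V, hV, he⟩
    refine ⟨subset_ground_of_mem_posCovectors hV he, ?_⟩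
    rintro ⟨U, hU, he'⟩
    exact Set.disjoint_left.1 (disjoint_of_mem_posCovectors_dual hV hU) he he'
  · rintro ⟨heE, he⟩
    exact (mem_posCovectors_or_mem_dual heE).resolve_left he

theorem sUnion_isPosCocircuit (M : OrientedMatroid α) :
    ⋃₀ {D | M.IsPosCocircuit D} = ⋃₀ M.posCovectors := by
  refine Set.Subset.antisymm (Set.sUnion_subset_sUnion fun D hD => hD.mem_posCovectors) ?_
  rintro e ⟨U, hU, he⟩
  obtain ⟨D, hD, heD, -⟩ := exists_isPosCocircuit_subset hU he
  exact ⟨D, hD, heD⟩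

theorem acyclic_iff : M.Acyclic ↔ M.E ∈ M.posCovectors := by
  constructor
  · intro h
    suffices hE : ⋃₀ M.posCovectors = M.E by
      exact hE ▸ M.supClosed_posCovectors.sSup_mem M.finite_posCovectors
        M.empty_mem_posCovectors subset_rfl
    refine Set.Subset.antisymm (Set.sUnion_subset fun _ => subset_ground_of_mem_posCovectors) ?_
    refine fun e he => (mem_posCovectors_or_mem_dual he).resolve_right ?_
    rintro ⟨V, hV, heV⟩
    obtain ⟨C, hC, -⟩ := exists_isPosCocircuit_subset hV heV
    exact h C hC
  · intro hE C (hC : M.dual.IsPosCocircuit C)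
    refine hC.nonempty.ne_empty (disjoint_self.1 ?_)
    exact (disjoint_of_mem_posCovectors_dual hC.mem_posCovectors hE).mono_right
      (subset_ground_of_mem_posCovectors hC.mem_posCovectors)

theorem bounded_iff : M.Bounded p ↔
    p ∈ M.E ∧ M.E ∈ M.posCovectors ∧ ∀ U ∈ M.posCovectors, U.Nonempty → p ∈ U := by
  refine and_congr_right fun _ => and_congr acyclic_iff
    ⟨fun h U hU ⟨e, he⟩ => ?_, fun h D hD => h D hD.mem_posCovectors hD.nonempty⟩
  obtain ⟨D, hD, -, hDU⟩ := exists_isPosCocircuit_subset hU he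
  exact hDU (h D hD)

theorem isPosCircuit_dual : M.dual.IsPosCircuit D ↔ M.IsPosCocircuit D := by
  simp only [IsPosCircuit, isCircuit_dual, IsPosCocircuit]

theorem totallyCyclic_iff : M.TotallyCyclic ↔ M.dual.Acyclic := by
  constructor
  · intro h D hD
    rw [isPosCircuit_dual] at hD
    obtain ⟨e, he⟩ := hD.nonempty
    obtain ⟨C, (hC : M.dual.IsPosCocircuit C), heC⟩ :=
      h e (subset_ground_of_mem_posCovectors hD.mem_posCovectors he)
    exact Set.disjoint_left.1
      (disjoint_of_mem_posCovectors_dual hC.mem_posCovectors hD.mem_posCovectors) heC he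
  · intro h e he
    obtain ⟨C, hC, heC, -⟩ := exists_isPosCocircuit_subset (acyclic_iff.1 h) he
    exact ⟨C, hC, heC⟩

theorem dualBounded_iff : M.DualBounded p ↔ M.dual.Bounded p :=
  and_congr_right fun _ => and_congr_left fun _ => totallyCyclic_iff

end PositiveCovectors

section Connectivity

variable {C D X : α → SignType} {p : α}

theorem exists_isCocircuit_elimination (hC : M.IsCocircuit C) (hD : M.IsCocircuit D)
    (heC : C e ≠ 0) (heD : D e = 0) (hfC : C f ≠ 0) (hfD : D f ≠ 0) :
    ∃ Z, M.IsCocircuit Z ∧ Z e ≠ 0 ∧ Z f = 0 ∧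
      Function.support Z ⊆ Function.support C ∪ Function.support D := by
  obtain ⟨D', hD', hf, hDD'⟩ : ∃ D' ∈ M.covectors, f ∈ sep D' C ∧
      Function.support D' = Function.support D := by
    rcases mem_sep_or_mem_sep_neg hfD hfC with h | h
    · exact ⟨D, hD.1, h, rfl⟩
    · exact ⟨-D, M.neg_mem D hD.1, h, support_neg D⟩
  have heD' : D' e = 0 := Function.notMem_support.1 (hDD' ▸ Function.notMem_support.2 heD)
  obtain ⟨Y, hY, hYf, hYg⟩ := M.elimination D' hD' C hC.1 f hf
  have hYe : Y e ≠ 0 := by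
    rwa [hYg e fun h => h.1 heD', comp_apply_of_eq_zero heD']
  have hYs : Function.support Y ⊆ Function.support C ∪ Function.support D := fun g hg => by
    rw [← hDD', Set.union_comm, ← support_comp]
    by_cases hgs : g ∈ sep D' C
    · exact support_comp D' C ▸ Or.inl hgs.1
    · rwa [Function.mem_support, hYg g hgs] at hg
  obtain ⟨Z, hZ, hZe, hZY⟩ := exists_isCocircuit_conformal hY hYe
  have hZY' : Function.support Z ⊆ Function.support Y := fun g hg => (hZY hg).symm.trans_ne hg
  exact ⟨Z, hZ, hZe.trans_ne hYe, Function.notMem_support.1 fun h => hZY' h hYf, hZY'.trans hYs⟩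

theorem IsCocircuit.exists_ne_zero_of_apply_eq_zero (hC : M.IsCocircuit C) (hD : M.IsCocircuit D)
    (hCe : C e ≠ 0) (hDe : D e = 0) : ∃ f, D f ≠ 0 ∧ C f = 0 := by
  by_contra! h
  exact (hC.2.2 D hD.1 hD.2.1 h).symm.subset hCe hDe

/-- Cocircuits `C ∋ e` and `D ∋ g` which meet and whose union is smallest possible would lead, by
eliminating a common element first from `C` and then from `D`, to a smaller union. -/
theorem exists_isCocircuit_trans (hC : M.IsCocircuit C) (hD : M.IsCocircuit D) (heC : C e ≠ 0)
    (hfC : C f ≠ 0) (hfD : D f ≠ 0) (hgD : D g ≠ 0) :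
    ∃ Z, M.IsCocircuit Z ∧ Z e ≠ 0 ∧ Z g ≠ 0 := by
  by_contra! hno
  induction hn : (Function.support C ∪ Function.support D).ncard using Nat.strong_induction_on
    generalizing C D f with
  | _ n ih =>
    have not_smaller : ∀ {C' D' : α → SignType}, M.IsCocircuit C' → M.IsCocircuit D' → C' e ≠ 0 →
        D' g ≠ 0 → (∃ h, C' h ≠ 0 ∧ D' h ≠ 0) →
        Function.support C' ∪ Function.support D' ⊆ Function.support C ∪ Function.support D →
        Function.support C ∪ Function.support D ⊆ Function.support C' ∪ Function.support D' := by
      rintro C' D' hC' hD' he hg ⟨h, hhC, hhD⟩ hsub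
      by_contra hlt
      exact ih _ (hn ▸ Set.ncard_lt_ncard ⟨hsub, hlt⟩
        ((finite_support hC.1).union (finite_support hD.1))) hC' hD' he hhC hhD hg rfl
    have hDe : D e = 0 := by
      by_contra h
      exact hgD (hno D hD h)
    obtain ⟨C', hC', heC', hfC', hC's⟩ :=
      exists_isCocircuit_elimination hC hD heC hDe hfC hfD
    obtain ⟨D', hD', hgD', hfD', hD's⟩ :=
      exists_isCocircuit_elimination hD hC hgD (hno C hC heC) hfD hfC
    rw [Set.union_comm] at hD's
    obtain ⟨h, hhC', hhC⟩ := hC.exists_ne_zero_of_apply_eq_zero hC' hfC hfC'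
    obtain ⟨h', hhD', hhD⟩ := hD.exists_ne_zero_of_apply_eq_zero hD' hfD hfD'
    have hC'D := not_smaller hC' hD heC' hgD ⟨h, hhC', (hC's hhC').resolve_left (· hhC)⟩
      (Set.union_subset hC's Set.subset_union_right)
    have hhC'' : C' h' ≠ 0 := (hC'D (hD's hhD')).resolve_right (· hhD)
    have hC'D' := not_smaller hC' hD' heC' hgD' ⟨h', hhC'', hhD'⟩ (Set.union_subset hC's hD's)
    exact (hC'D' (Or.inl hfC)).elim (· hfC') (· hfD')

theorem indicator_mem_covectors (hX : X ∈ M.covectors) {T : Set α}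
    (hT : ∀ C, M.IsCircuit C → Function.support C ⊆ T ∨ Disjoint (Function.support C) T) :
    T.indicator X ∈ M.covectors := by
  refine mem_covectors_of_forall_isCircuit (fun e he => ?_) fun C hC => ?_
  · exact M.support_subset X hX (Set.indicator_apply_ne_zero.1 he).2
  rcases hT C hC with h | h
  · have mul_indicator : ∀ e, C e * T.indicator X e = C e * X e := fun e => by
      by_cases he : C e = 0
      · simp [he]
      · rw [Set.indicator_of_mem (h he)]
    simpa only [Orthogonal, mul_indicator] using hC.1.2 X hX
  · refine Or.inl fun e => ?_
    by_cases he : C e = 0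
    · simp [he]
    · rw [Set.indicator_of_notMem (Set.disjoint_left.1 h he), mul_zero]

/-- If no circuit contains `e` and `f`, then a cocircuit containing both splits along the connected
component of `e`. -/
theorem Connected.of_dual (h : M.dual.Connected) : M.Connected := by
  intro e he f hf hef
  by_contra! hno
  obtain ⟨D, hD, hDe, hDf⟩ := h e he f hf hef
  rw [isCircuit_dual] at hD
  set T : Set α := {g | g = e ∨ ∃ C, M.IsCircuit C ∧ C e ≠ 0 ∧ C g ≠ 0} with hTdef
  have hfT : f ∉ T := by
    rintro (h | ⟨C, hC, hCe, hCf⟩)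
    exacts [hef h.symm, hCf (hno C hC hCe)]
  have hDT : T.indicator D ∈ M.covectors := by
    refine indicator_mem_covectors hD.1 fun C hC => or_iff_not_imp_right.2 fun hCT g hg => ?_
    obtain ⟨h, hCh, rfl | ⟨B, hB, hBe, hBh⟩⟩ := Set.not_disjoint_iff.1 hCT
    · exact Or.inr ⟨C, hC, hCh, hg⟩
    · exact Or.inr (exists_isCocircuit_trans (M := M.dual) hB hC hBe hBh hCh hg)
  have hsupp := hD.2.2 _ hDT
    (fun h => hDe (by simpa [hTdef] using congrFun h e))
    (fun g hg => (Set.indicator_apply_ne_zero.1 hg).2)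
  exact hfT (Set.indicator_apply_ne_zero.1 (hsupp.symm.subset hDf)).1

theorem Bounded.dual_connected (h : M.Bounded p) : M.dual.Connected := by
  have hE := acyclic_iff.1 h.2.1
  have exists_common : ∀ e ∈ M.E, ∃ D, M.IsCocircuit D ∧ D e ≠ 0 ∧ D p ≠ 0 := fun e he => by
    obtain ⟨_, hD, heD, -⟩ := exists_isPosCocircuit_subset hE he
    have hpD := h.2.2 _ hD
    obtain ⟨D, hD, -, rfl⟩ := hD
    exact ⟨D, hD, heD, hpD⟩
  intro e he f hf _
  obtain ⟨C, hC, heC, hpC⟩ := exists_common e he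
  obtain ⟨D, hD, hfD, hpD⟩ := exists_common f hf
  simp only [isCircuit_dual]
  exact exists_isCocircuit_trans hC hD heC hpC hpD hfD

theorem Bounded.connected (h : M.Bounded p) : M.Connected :=
  h.dual_connected.of_dual

theorem DualBounded.connected (h : M.DualBounded p) : M.Connected :=
  M.dual_dual ▸ (dualBounded_iff.1 h).dual_connected

theorem Acyclic.not_isLoop (h : M.Acyclic) : ¬ M.IsLoop := by
  rintro ⟨e, -, C, hC, hCe⟩
  have nonneg_of : ∀ X : α → SignType, Function.support X = {e} → 0 ≤ X e → 0 ≤ X :=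
    fun X hX hXe f => by
      by_cases hf : X f = 0
      · exact hf.ge
      · obtain rfl : f = e := by simpa [hX] using Function.mem_support.2 hf
        exact hXe
  have he : {e} ∈ M.dual.posCovectors := by
    have sign_fact : ∀ s : SignType, 0 ≤ s ∨ 0 ≤ -s := by decide
    have hCe' : Function.support (-C) = {e} := (support_neg C).trans hCe
    rcases sign_fact (C e) with h | h
    · exact ⟨C, hC.1, nonneg_of C hCe h, hCe⟩
    · exact ⟨-C, neg_mem_vectors hC.1, nonneg_of (-C) hCe' h, hCe'⟩
  exact Set.disjoint_left.1 (disjoint_of_mem_posCovectors_dual he (acyclic_iff.1 h)) rfl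
    (subset_ground_of_mem_posCovectors he rfl)

theorem isLoop_dual : M.dual.IsLoop ↔ M.IsIsthmus := by
  simp only [IsLoop, isCircuit_dual]
  exact Iff.rfl

theorem DualBounded.not_isIsthmus (h : M.DualBounded p) : ¬ M.IsIsthmus := by
  rw [← isLoop_dual]
  exact (dualBounded_iff.1 h).2.1.not_isLoop

end Connectivity

section Minors

variable {F G U V : Set α} {p : α}

theorem union_sdiff_mem_posCovectors (hG : M.E \ G ∈ M.posCovectors)
    (hU : U ∈ ((M.restrict G).contract F).posCovectors) : U ∪ M.E \ G ∈ M.posCovectors := by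
  obtain ⟨_, ⟨⟨X, hX, rfl⟩, -⟩, hX0, rfl⟩ := hU
  obtain ⟨Y, hY, hY0, hYG⟩ := hG
  have hYG' : ∀ e, Y e ≠ 0 ↔ e ∈ M.E ∧ e ∉ G := fun e => Set.ext_iff.1 hYG e
  refine ⟨comp Y X, M.comp_mem Y hY X hX, fun e => ?_, ?_⟩
  · by_cases he : Y e = 0
    · rw [comp_apply_of_eq_zero he]
      by_cases heG : e ∈ G
      · simpa [heG] using hX0 e
      · exact (covector_apply_eq_zero hX fun heE => (hYG' e).2 ⟨heE, heG⟩ he).ge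
    · rw [comp_apply_of_ne_zero he]
      exact hY0 e
  · ext e
    have := M.support_subset X hX (a := e)
    simp only [support_comp, hYG, Set.mem_union, Set.mem_sdiff, Set.support_indicator,
      Set.mem_inter_iff]
    tauto

theorem inter_mem_posCovectors_minor (hV : V ∈ M.posCovectors) (hVF : Disjoint V F) :
    G ∩ V ∈ ((M.restrict G).contract F).posCovectors := by
  obtain ⟨X, hX, hX0, rfl⟩ := hV
  refine ⟨G.indicator X, ⟨⟨X, hX, rfl⟩, fun e he => ?_⟩,
    fun e => Set.indicator_apply_nonneg fun _ => hX0 e, Set.support_indicator ..⟩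
  have : X e = 0 := Function.notMem_support.1 (Set.disjoint_right.1 hVF he)
  simp [Set.indicator, this]

theorem bounded_minor_iff (hFG : F ⊆ G) (hG : M.E \ G ∈ M.posCovectors) :
    ((M.restrict G).contract F).Bounded p ↔ p ∈ (M.E ∩ G) \ F ∧ M.E \ F ∈ M.posCovectors ∧
      ∀ V ∈ M.posCovectors, M.E \ G ⊂ V → V ⊆ M.E \ F → p ∈ V := by
  have ground_eq : (M.E ∩ G) \ F ∪ M.E \ G = M.E \ F := by
    ext e
    have := @hFG e
    simp only [Set.mem_union, Set.mem_sdiff, Set.mem_inter_iff]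
    tauto
  have disjoint_of_subset : ∀ {V}, V ⊆ M.E \ F → Disjoint V F := fun h =>
    Set.disjoint_sdiff_left.mono_left h
  rw [bounded_iff]
  refine and_congr_right fun hp => and_congr ⟨fun h => ?_, fun h => ?_⟩
    ⟨fun h V hV hGV hVF => ?_, fun h U hU hne => ?_⟩
  · exact ground_eq ▸ union_sdiff_mem_posCovectors hG h
  · convert inter_mem_posCovectors_minor (G := G) h (disjoint_of_subset subset_rfl) using 1
    exact (congrArg (· \ F) (Set.inter_comm ..)).trans (Set.inter_sdiff_assoc ..)
  · refine (h _ (inter_mem_posCovectors_minor hV (disjoint_of_subset hVF)) ?_).2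
    obtain ⟨e, heV, he⟩ := Set.exists_of_ssubset hGV
    exact ⟨e, by_contra fun heG => he ⟨(hVF heV).1, heG⟩, heV⟩
  · have hUE : U ⊆ (M.E ∩ G) \ F := subset_ground_of_mem_posCovectors hU
    obtain ⟨e, he⟩ := hne
    have hss : M.E \ G ⊂ U ∪ M.E \ G :=
      ⟨Set.subset_union_right, fun hss => (hss (Or.inl he)).2 (hUE he).1.2⟩
    exact (h _ (union_sdiff_mem_posCovectors hG hU) hss
      (ground_eq ▸ Set.union_subset_union_left _ hUE)).resolve_right fun h => h.2 hp.1.2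

end Minors

end OrientedMatroid

section MinChains

variable {α : Type*} {n m : ℕ} {U : Fin (n + 1) → Set α} {W : Fin (m + 1) → Set α}
  {a : Fin n → α} {b : Fin m → α} {𝒰 : Set (Set α)} {V : Set α}

theorem exists_castSucc_and_not_succ {P : Fin (n + 1) → Prop} (h0 : P 0)
    (hlast : ¬P (Fin.last n)) : ∃ j : Fin n, P j.castSucc ∧ ¬P j.succ := by
  by_contra! h
  exact hlast (Fin.induction h0 h (Fin.last n))

variable [LinearOrder α]

/-- Each half of a filtration, written as a chain decreasing to `∅`; the smallest elements `a k` of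
the successive differences increase. The half `F_0 ⊂ ⋯ ⊂ F_ι = E` becomes `U k = E \ F_k`. -/
structure IsMinChain (U : Fin (n + 1) → Set α) (a : Fin n → α) : Prop where
  last : U (Fin.last n) = ∅
  strictAnti : StrictAnti U
  strictMono : StrictMono a
  isLeast_sdiff : ∀ k, IsLeast (U k.castSucc \ U k.succ) (a k)

/-- A chain of members of `𝒰` such that each step from `U k.succ` up to `U k.castSucc` within `𝒰`
has to pick up the smallest element `a k`. For `𝒰 = M.posCovectors` and `U k = M.E \ F_k` this
expresses the boundedness of the minors `M(F_k)/F_{k-1}`. -/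
structure IsActiveChain (𝒰 : Set (Set α)) (U : Fin (n + 1) → Set α) (a : Fin n → α) : Prop
    extends IsMinChain U a where
  mem : ∀ k, U k ∈ 𝒰
  min_mem : ∀ k, ∀ V ∈ 𝒰, U k.succ ⊂ V → V ⊆ U k.castSucc → a k ∈ V

/-- The smallest elements of the members of `𝒰`: the active or dual-active elements, for the
positive vectors or covectors of an oriented matroid. -/
def minima (𝒰 : Set (Set α)) : Set α :=
  {x | ∃ V ∈ 𝒰, IsLeast V x}

/-- The union of the members of `𝒰` whose smallest element is at least `a k`, where `a` enumerates
`minima 𝒰`. Phrasing this with indices gives the value `∅` at `Fin.last n`. -/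
def activeChain (𝒰 : Set (Set α)) (a : Fin n → α) (k : Fin (n + 1)) : Set α :=
  ⋃₀ {V ∈ 𝒰 | ∃ j, k ≤ j.castSucc ∧ IsLeast V (a j)}

theorem activeChain_last : activeChain 𝒰 a (Fin.last n) = ∅ :=
  Set.sUnion_eq_empty.2 fun _ ⟨_, j, hj, _⟩ => absurd hj (Fin.castSucc_lt_last j).not_ge

theorem antitone_activeChain : Antitone (activeChain 𝒰 a) := fun _ _ hkl =>
  Set.sUnion_subset_sUnion fun _ ⟨hV, j, hlj, hj⟩ => ⟨hV, j, hkl.trans hlj, hj⟩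

theorem activeChain_mem (hfin : (⋃₀ 𝒰).Finite) (hempty : ∅ ∈ 𝒰) (hsup : SupClosed 𝒰)
    (k : Fin (n + 1)) : activeChain 𝒰 a k ∈ 𝒰 :=
  hsup.sSup_mem ((hfin.finite_subsets.subset fun _ => Set.subset_sUnion_of_mem).subset
    fun _ hV => hV.1) hempty fun _ hV => hV.1

theorem exists_isLeast_of_range_eq (hfin : (⋃₀ 𝒰).Finite) (hrange : Set.range a = minima 𝒰)
    (hV : V ∈ 𝒰) (hne : V.Nonempty) : ∃ j, IsLeast V (a j) := by
  obtain ⟨x, hxV, hx⟩ :=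
    Set.exists_min_image V id (hfin.subset (Set.subset_sUnion_of_mem hV)) hne
  obtain ⟨j, rfl⟩ := hrange.symm.subset ⟨V, hV, hxV, hx⟩
  exact ⟨j, hxV, hx⟩

theorem activeChain_zero (hfin : (⋃₀ 𝒰).Finite) (hrange : Set.range a = minima 𝒰) :
    activeChain 𝒰 a 0 = ⋃₀ 𝒰 := by
  refine Set.Subset.antisymm (Set.sUnion_subset_sUnion fun _ hV => hV.1) ?_
  rintro x ⟨V, hV, hx⟩
  obtain ⟨j, hj⟩ := exists_isLeast_of_range_eq hfin hrange hV ⟨x, hx⟩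
  exact ⟨V, ⟨hV, j, Fin.zero_le _, hj⟩, hx⟩

theorem isLeast_activeChain_sdiff (ha : StrictMono a) (hrange : Set.range a = minima 𝒰)
    (k : Fin n) : IsLeast (activeChain 𝒰 a k.castSucc \ activeChain 𝒰 a k.succ) (a k) := by
  obtain ⟨V, hV, hk⟩ := hrange.subset ⟨k, rfl⟩
  refine ⟨⟨⟨V, ⟨hV, k, le_rfl, hk⟩, hk.1⟩, ?_⟩, ?_⟩
  · rintro ⟨W, ⟨-, j, hkj, hj⟩, hkW⟩
    exact (hj.2 hkW).not_gt (ha (Fin.succ_le_castSucc_iff.1 hkj))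
  · rintro x ⟨⟨W, ⟨-, j, hkj, hj⟩, hxW⟩, -⟩
    exact (ha.monotone (Fin.castSucc_le_castSucc_iff.1 hkj)).trans (hj.2 hxW)

theorem isActiveChain_activeChain (hfin : (⋃₀ 𝒰).Finite) (hempty : ∅ ∈ 𝒰) (hsup : SupClosed 𝒰)
    (ha : StrictMono a) (hrange : Set.range a = minima 𝒰) :
    IsActiveChain 𝒰 (activeChain 𝒰 a) a where
  last := activeChain_last
  strictAnti := Fin.strictAnti_iff_succ_lt.2 fun k =>
    have hk := (isLeast_activeChain_sdiff ha hrange k).1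
    ⟨antitone_activeChain Fin.castSucc_lt_succ.le, fun h => hk.2 (h hk.1)⟩
  strictMono := ha
  isLeast_sdiff := isLeast_activeChain_sdiff ha hrange
  mem := activeChain_mem hfin hempty hsup
  min_mem k V hV hlt hle := by
    obtain ⟨x, hx, -⟩ := Set.exists_of_ssubset hlt
    obtain ⟨j, hj⟩ := exists_isLeast_of_range_eq hfin hrange hV ⟨x, hx⟩
    have hjk : j ≤ k := by
      by_contra! hkj
      exact hlt.not_subset (Set.subset_sUnion_of_mem ⟨hV, j, Fin.succ_le_castSucc_iff.2 hkj, hj⟩)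
    obtain ⟨W, ⟨-, i, hki, hi⟩, hjW⟩ := hle hj.1
    have hkj : k ≤ j :=
      (Fin.castSucc_le_castSucc_iff.1 hki).trans (ha.le_iff_le.1 (hi.2 hjW))
    exact hkj.antisymm hjk ▸ hj.1

theorem IsMinChain.isLeast (h : IsMinChain U a) (k : Fin n) : IsLeast (U k.castSucc) (a k) := by
  refine ⟨(h.isLeast_sdiff k).1.1, fun x hx => ?_⟩
  obtain ⟨i, hi⟩ := exists_castSucc_and_not_succ (P := fun i => x ∈ U i)
    (h.strictAnti.antitone (Fin.zero_le _) hx) (h.last ▸ Set.notMem_empty x)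
  have hki : k ≤ i := by
    by_contra! hik
    exact hi.2 (h.strictAnti.antitone (Fin.succ_le_castSucc_iff.2 hik) hx)
  exact (h.strictMono.monotone hki).trans ((h.isLeast_sdiff i).2 hi)

namespace IsActiveChain

theorem exists_isLeast (h : IsActiveChain 𝒰 U a) (hsup : SupClosed 𝒰) (hV : V ∈ 𝒰)
    (hne : V.Nonempty) (hV0 : V ⊆ U 0) : ∃ j, IsLeast V (a j) ∧ V ⊆ U j.castSucc := by
  obtain ⟨j, hj, hj'⟩ := exists_castSucc_and_not_succ (P := fun k => V ⊆ U k) hV0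
    fun hV => hne.ne_empty (Set.subset_empty_iff.1 (h.last ▸ hV))
  have hmem : a j ∈ V ∪ U j.succ :=
    h.min_mem j _ (hsup hV (h.mem _)) ⟨Set.subset_union_right, fun h => hj' fun _ hx => h (.inl hx)⟩
      (Set.union_subset hj (h.strictAnti.antitone Fin.castSucc_lt_succ.le))
  exact ⟨j, ⟨hmem.resolve_right (h.isLeast_sdiff j).1.2, fun x hx => (h.isLeast j).2 (hj hx)⟩, hj⟩

theorem range_eq (h : IsActiveChain 𝒰 U a) (hsup : SupClosed 𝒰) (h0 : ∀ V ∈ 𝒰, V ⊆ U 0) :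
    Set.range a = minima 𝒰 := by
  ext x
  constructor
  · rintro ⟨k, rfl⟩
    exact ⟨_, h.mem _, h.isLeast k⟩
  · rintro ⟨V, hV, hx⟩
    obtain ⟨j, hj, -⟩ := h.exists_isLeast hsup hV ⟨x, hx.1⟩ (h0 V hV)
    exact ⟨j, hj.unique hx⟩

theorem eq_activeChain (h : IsActiveChain 𝒰 U a) (hsup : SupClosed 𝒰) (h0 : ∀ V ∈ 𝒰, V ⊆ U 0) :
    U = activeChain 𝒰 a := by
  funext k
  apply Set.Subset.antisymm
  · cases k using Fin.lastCases with
    | last => exact h.last.subset.trans (Set.empty_subset _)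
    | cast k => exact Set.subset_sUnion_of_mem ⟨h.mem _, k, le_rfl, h.isLeast k⟩
  · rintro x ⟨V, ⟨hV, i, hki, hi⟩, hx⟩
    obtain ⟨j, hj, hVj⟩ := h.exists_isLeast hsup hV ⟨x, hx⟩ (h0 V hV)
    obtain rfl := h.strictMono.injective (hj.unique hi)
    exact h.strictAnti.antitone hki (hVj hx)

theorem sigma_eq (h : IsActiveChain 𝒰 U a) (h' : IsActiveChain 𝒰 W b) (hsup : SupClosed 𝒰)
    (h0 : ∀ V ∈ 𝒰, V ⊆ U 0) (h0' : ∀ V ∈ 𝒰, V ⊆ W 0) :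
    (⟨n, U⟩ : (n : ℕ) × (Fin (n + 1) → Set α)) = ⟨m, W⟩ := by
  have hrange : Set.range a = Set.range b :=
    (h.range_eq hsup h0).trans (h'.range_eq hsup h0').symm
  have hnm : n = m := by
    simpa [Set.ncard_image_of_injective, h.strictMono.injective, h'.strictMono.injective,
      ← Set.image_univ] using congrArg Set.ncard hrange
  subst hnm
  obtain rfl := (h.strictMono.range_inj h'.strictMono).1 hrange
  rw [h.eq_activeChain hsup h0, h'.eq_activeChain hsup h0']

end IsActiveChain

end MinChains

namespace OrientedMatroid

variable {α : Type*} [LinearOrder α] {M : OrientedMatroid α} {n : ℕ} {F : Fin (n + 1) → Set α}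
  {a : Fin n → α} {E : Set α} {S T : FiltrationSeq α}

theorem isMinChain_compl_iff (hE : ∀ k, F k ⊆ E) : IsMinChain (fun k => E \ F k) a ↔
    F (Fin.last n) = E ∧ StrictMono F ∧ StrictMono a ∧
      ∀ k, IsLeast (F k.succ \ F k.castSucc) (a k) := by
  have last_iff : E \ F (Fin.last n) = ∅ ↔ F (Fin.last n) = E :=
    Set.sdiff_eq_empty.trans ⟨(hE _).antisymm, fun h => h.ge⟩
  have strict_iff : StrictAnti (fun k => E \ F k) ↔ StrictMono F :=
    forall₂_congr fun k l => imp_congr_right fun _ => by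
      simp only [Set.ssubset_def, Set.sdiff_subset_sdiff_iff_subset (hE _) (hE _)]
  have sdiff_eq : ∀ k l, (E \ F k) \ (E \ F l) = F l \ F k := fun k l =>
    sdiff_sdiff_sdiff_cancel_left (hE l)
  constructor
  · rintro ⟨hlast, hanti, ha, hmin⟩
    exact ⟨last_iff.1 hlast, strict_iff.1 hanti, ha, fun k => sdiff_eq .. ▸ hmin k⟩
  · rintro ⟨hlast, hmono, ha, hmin⟩
    exact ⟨last_iff.2 hlast, strict_iff.2 hmono, ha, fun k => (sdiff_eq ..).symm ▸ hmin k⟩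

theorem isActiveChain_compl_iff (hF : Monotone F) (h : IsMinChain (fun k => M.E \ F k) a) :
    IsActiveChain M.posCovectors (fun k => M.E \ F k) a ↔
      ∀ k, ((M.restrict (F k.succ)).contract (F k.castSucc)).Bounded (a k) := by
  have hsub : ∀ k : Fin n, F k.castSucc ⊆ F k.succ := fun k => hF Fin.castSucc_lt_succ.le
  constructor
  · intro hA k
    obtain ⟨⟨haE, hak⟩, hak'⟩ := (h.isLeast_sdiff k).1
    exact (bounded_minor_iff (hsub k) (hA.mem k.succ)).2
      ⟨⟨⟨haE, by_contra fun h => hak' ⟨haE, h⟩⟩, hak⟩, hA.mem k.castSucc, hA.min_mem k⟩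
  · intro hB
    have hmem : ∀ k, M.E \ F k ∈ M.posCovectors := fun k => by
      induction k using Fin.reverseInduction with
      | last => exact h.last ▸ M.empty_mem_posCovectors
      | cast k ih => exact ((bounded_minor_iff (hsub k) ih).1 (hB k)).2.1
    exact ⟨h, hmem, fun k => ((bounded_minor_iff (hsub k) (hmem _)).1 (hB k)).2.2⟩

theorem isActiveChain_dual_iff (hE : ∀ k, F k ⊆ M.E) (h : IsMinChain F a) :
    IsActiveChain M.dual.posCovectors F a ↔
      ∀ k, ((M.restrict (F k.castSucc)).contract (F k.succ)).DualBounded (a k) := by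
  have hF : (fun k => M.dual.E \ (F k)ᶜ) = F := funext fun k => by
    rw [Set.sdiff_compl]
    exact Set.inter_eq_right.2 (hE k)
  have hanti := h.strictAnti.antitone
  have key := isActiveChain_compl_iff (M := M.dual) (F := fun k => (F k)ᶜ) (a := a)
    (fun _ _ hkl => Set.compl_subset_compl.2 (hanti hkl)) (hF.symm ▸ h)
  rw [hF] at key
  refine key.trans (forall_congr' fun k => ?_)
  rw [dualBounded_iff, dual_minor (hanti Fin.castSucc_lt_succ.le)]

/-- The description of the filtrations of the theorem in terms of positive covectors and positive
vectors only, both halves being decreasing chains of such. -/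
structure HasActiveChains (M : OrientedMatroid α) (S : FiltrationSeq α) : Prop where
  F_subset : ∀ k, S.F k ⊆ M.E
  F_zero : S.F 0 = S.Fc
  F'_zero : S.F' 0 = S.Fc
  isActiveChain_F : ∃ a, IsActiveChain M.posCovectors (fun k => M.E \ S.F k) a
  isActiveChain_F' : ∃ a, IsActiveChain M.dual.posCovectors S.F' a

theorem HasActiveChains.isFiltration (h : M.HasActiveChains S) : S.IsFiltration M.E := by
  obtain ⟨a, ha⟩ := h.isActiveChain_F
  obtain ⟨a', ha'⟩ := h.isActiveChain_F'
  obtain ⟨htop, hmono, ha0, hmin⟩ := (isMinChain_compl_iff h.F_subset).1 ha.toIsMinChain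
  exact ⟨ha'.last, ha'.strictAnti, h.F'_zero, h.F_zero, hmono, htop, ⟨a, ha0, hmin⟩,
    a', ha'.strictMono, ha'.isLeast_sdiff⟩

theorem HasActiveChains.hasBoundedMinors (h : M.HasActiveChains S) : M.HasBoundedMinors S := by
  obtain ⟨a, ha⟩ := h.isActiveChain_F
  obtain ⟨a', ha'⟩ := h.isActiveChain_F'
  obtain ⟨-, hmono, -, hmin⟩ := (isMinChain_compl_iff h.F_subset).1 ha.toIsMinChain
  have hE' : ∀ k, S.F' k ⊆ M.E := fun k =>
    subset_ground_of_mem_posCovectors (M := M.dual) (ha'.mem k)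
  exact ⟨fun k => ⟨a k, hmin k,
      (isActiveChain_compl_iff hmono.monotone ha.toIsMinChain).1 ha k⟩,
    fun k => ⟨a' k, ha'.isLeast_sdiff k, (isActiveChain_dual_iff hE' ha'.toIsMinChain).1 ha' k⟩⟩

theorem HasBoundedMinors.hasActiveChains (h : M.HasBoundedMinors S) (hS : S.IsFiltration M.E) :
    M.HasActiveChains S := by
  obtain ⟨a, ha, hmin⟩ := hS.min_F
  obtain ⟨a', ha', hmin'⟩ := hS.min_F'
  have hE : ∀ k, S.F k ⊆ M.E := fun k => hS.top ▸ hS.strictMono.monotone (Fin.le_last k)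
  have hE' : ∀ k, S.F' k ⊆ M.E := fun k => (hS.strictAnti.antitone (Fin.zero_le k)).trans
    ((hS.F'_zero.trans hS.F_zero.symm).subset.trans (hE 0))
  have hchain : IsMinChain (fun k => M.E \ S.F k) a :=
    (isMinChain_compl_iff hE).2 ⟨hS.top, hS.strictMono, ha, hmin⟩
  have hchain' : IsMinChain S.F' a' := ⟨hS.bot, hS.strictAnti, ha', hmin'⟩
  refine ⟨hE, hS.F_zero, hS.F'_zero,
    ⟨a, (isActiveChain_compl_iff hS.strictMono.monotone hchain).2 fun k => ?_⟩,
    ⟨a', (isActiveChain_dual_iff hE' hchain').2 fun k => ?_⟩⟩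
  · obtain ⟨b, hb, hbounded⟩ := h.bounded k
    exact (hmin k).unique hb ▸ hbounded
  · obtain ⟨b, hb, hbounded⟩ := h.dualBounded k
    exact (hmin' k).unique hb ▸ hbounded

theorem HasBoundedMinors.isConnectedFiltration (h : M.HasBoundedMinors S)
    (hS : S.IsFiltration M.E) : M.IsConnectedFiltration S where
  isFiltration := hS
  connected_F k := by
    obtain ⟨a, -, ha⟩ := h.bounded k
    exact ⟨ha.connected, ha.2.1.not_isLoop⟩
  connected_F' k := by
    obtain ⟨a, -, ha⟩ := h.dualBounded k
    exact ⟨ha.connected, ha.not_isIsthmus⟩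

theorem HasActiveChains.subset_compl_F_zero (h : M.HasActiveChains S) {U : Set α}
    (hU : U ∈ M.posCovectors) : U ⊆ M.E \ S.F 0 := by
  obtain ⟨a', ha'⟩ := h.isActiveChain_F'
  refine Set.subset_sdiff.2 ⟨subset_ground_of_mem_posCovectors hU, ?_⟩
  rw [h.F_zero, ← h.F'_zero]
  exact (disjoint_of_mem_posCovectors_dual (ha'.mem 0) hU).symm

theorem HasActiveChains.subset_F'_zero (h : M.HasActiveChains S) {V : Set α}
    (hV : V ∈ M.dual.posCovectors) : V ⊆ S.F' 0 := by
  obtain ⟨a, ha⟩ := h.isActiveChain_F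
  rw [h.F'_zero, ← h.F_zero]
  exact (disjoint_sdiff_iff_le (subset_ground_of_mem_posCovectors (M := M.dual) hV)
    (h.F_subset 0)).1 (disjoint_of_mem_posCovectors_dual hV (ha.mem 0))

theorem HasActiveChains.unique (hS : M.HasActiveChains S) (hT : M.HasActiveChains T) : S = T := by
  obtain ⟨a, ha⟩ := hS.isActiveChain_F
  obtain ⟨b, hb⟩ := hT.isActiveChain_F
  obtain ⟨a', ha'⟩ := hS.isActiveChain_F'
  obtain ⟨b', hb'⟩ := hT.isActiveChain_F'
  have hcompl := ha.sigma_eq hb M.supClosed_posCovectors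
    (fun _ => hS.subset_compl_F_zero) fun _ => hT.subset_compl_F_zero
  have hF' := ha'.sigma_eq hb' M.dual.supClosed_posCovectors
    (fun _ => hS.subset_F'_zero) fun _ => hT.subset_F'_zero
  have hF : (⟨S.ι, S.F⟩ : (n : ℕ) × (Fin (n + 1) → Set α)) = ⟨T.ι, T.F⟩ := by
    simpa only [Set.sdiff_sdiff_cancel_left (hS.F_subset _),
      Set.sdiff_sdiff_cancel_left (hT.F_subset _)] using
      congrArg (fun U => (⟨U.1, fun k => M.E \ U.2 k⟩ : (n : ℕ) × (Fin (n + 1) → Set α))) hcompl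
  obtain ⟨ι, ε, F, Fc, F'⟩ := S
  obtain ⟨ι₁, ε₁, F₁, Fc₁, F₁'⟩ := T
  obtain ⟨rfl, hF⟩ := Sigma.mk.inj hF
  obtain ⟨rfl, hF'⟩ := Sigma.mk.inj hF'
  obtain rfl := eq_of_heq hF
  obtain rfl := eq_of_heq hF'
  obtain rfl : Fc = Fc₁ := hS.F_zero.symm.trans hT.F_zero
  rfl

theorem minima_posCovectors (M : OrientedMatroid α) : minima M.posCovectors = M.dualActive := by
  ext x
  constructor
  · rintro ⟨U, hU, hx⟩
    obtain ⟨D, hD, hxD, hDU⟩ := exists_isPosCocircuit_subset hU hx.1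
    exact ⟨D, hD, hxD, fun y hy => hx.2 (hDU hy)⟩
  · rintro ⟨D, hD, hx⟩
    exact ⟨D, hD.mem_posCovectors, hx⟩

/-- The increasing enumeration of the dual-active elements, with `a_{k+1}` as its value at `k`. The
active elements are enumerated by `M.dual.dualActiveEmb`. -/
noncomputable def dualActiveEmb (M : OrientedMatroid α) :
    Fin M.dualActive_finite.toFinset.card ↪o α :=
  M.dualActive_finite.toFinset.orderEmbOfFin rfl

theorem range_dualActiveEmb (M : OrientedMatroid α) :
    Set.range M.dualActiveEmb = minima M.posCovectors := by
  rw [dualActiveEmb, Finset.range_orderEmbOfFin, Set.Finite.coe_toFinset, minima_posCovectors]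

theorem isActiveChain_dualActiveEmb (M : OrientedMatroid α) :
    IsActiveChain M.posCovectors (activeChain M.posCovectors M.dualActiveEmb) M.dualActiveEmb :=
  isActiveChain_activeChain M.finite_sUnion_posCovectors M.empty_mem_posCovectors
    M.supClosed_posCovectors M.dualActiveEmb.strictMono M.range_dualActiveEmb

theorem sUnion_isPosCocircuit_le (M : OrientedMatroid α)
    (k : Fin M.dualActive_finite.toFinset.card) :
    ⋃₀ {D | M.IsPosCocircuit D ∧ ∃ m, IsLeast D m ∧ M.dualActiveEmb k ≤ m} =
      activeChain M.posCovectors M.dualActiveEmb k.castSucc := by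
  have exists_isLeast : ∀ {D}, M.IsPosCocircuit D → ∃ j, IsLeast D (M.dualActiveEmb j) :=
    fun hD => exists_isLeast_of_range_eq M.finite_sUnion_posCovectors M.range_dualActiveEmb
      hD.mem_posCovectors hD.nonempty
  apply Set.Subset.antisymm
  · rintro x ⟨D, ⟨hD, m, hm, hkm⟩, hx⟩
    obtain ⟨j, hj⟩ := exists_isLeast hD
    rw [hm.unique hj, OrderEmbedding.le_iff_le] at hkm
    exact ⟨D, ⟨hD.mem_posCovectors, j, Fin.castSucc_le_castSucc_iff.2 hkm, hj⟩, hx⟩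
  · rintro x ⟨U, ⟨hU, j, hkj, hj⟩, hx⟩
    obtain ⟨D, hD, hxD, hDU⟩ := exists_isPosCocircuit_subset hU hx
    obtain ⟨i, hi⟩ := exists_isLeast hD
    have hki : M.dualActiveEmb k ≤ M.dualActiveEmb i :=
      (M.dualActiveEmb.monotone (Fin.castSucc_le_castSucc_iff.1 hkj)).trans (hj.2 (hDU hi.1))
    exact ⟨D, ⟨hD, _, hi, hki⟩, hxD⟩

theorem activeFiltration_F (M : OrientedMatroid α) :
    M.activeFiltration.F = fun k => M.E \ activeChain M.posCovectors M.dualActiveEmb k := by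
  funext (k : Fin (M.dualActive_finite.toFinset.card + 1))
  simp only [activeFiltration]
  cases k using Fin.lastCases with
  | last => rw [activeChain_last, Set.sdiff_empty, Fin.snoc_last]
  | cast k => rw [← sUnion_isPosCocircuit_le, Fin.snoc_castSucc, dualActiveEmb]

theorem activeFiltration_F' (M : OrientedMatroid α) :
    M.activeFiltration.F' = activeChain M.dual.posCovectors M.dual.dualActiveEmb := by
  funext (k : Fin (M.active_finite.toFinset.card + 1))
  simp only [activeFiltration]
  cases k using Fin.lastCases with
  | last => exact (Fin.snoc_last ..).trans activeChain_last.symm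
  | cast k => exact (Fin.snoc_castSucc ..).trans (M.dual.sUnion_isPosCocircuit_le k)

theorem hasActiveChains_activeFiltration (M : OrientedMatroid α) :
    M.HasActiveChains M.activeFiltration where
  F_subset k := by
    rw [activeFiltration_F]
    exact Set.sdiff_subset
  F_zero := by
    rw [activeFiltration_F]
    exact (congrArg (M.E \ ·)
        (activeChain_zero M.finite_sUnion_posCovectors M.range_dualActiveEmb)).trans
      (M.sUnion_dual_posCovectors.symm.trans M.dual.sUnion_isPosCocircuit.symm)
  F'_zero := by
    rw [activeFiltration_F']
    exact (activeChain_zero M.dual.finite_sUnion_posCovectors M.dual.range_dualActiveEmb).trans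
      M.dual.sUnion_isPosCocircuit.symm
  isActiveChain_F := by
    have h := M.isActiveChain_dualActiveEmb
    have sdiff_sdiff : (fun k => M.E \ (M.E \ activeChain M.posCovectors M.dualActiveEmb k)) =
        activeChain M.posCovectors M.dualActiveEmb := funext fun k =>
      Set.sdiff_sdiff_cancel_left (subset_ground_of_mem_posCovectors (h.mem k))
    rw [activeFiltration_F]
    exact ⟨M.dualActiveEmb, sdiff_sdiff.symm ▸ h⟩
  isActiveChain_F' := ⟨M.dual.dualActiveEmb, by
    rw [activeFiltration_F']
    exact M.dual.isActiveChain_dualActiveEmb⟩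

end OrientedMatroid

theorem theorem4p4 {α : Type*} [LinearOrder α] (M : OrientedMatroid α) :
    M.IsConnectedFiltration M.activeFiltration ∧
      M.HasBoundedMinors M.activeFiltration ∧
      ∀ S : FiltrationSeq α, S.IsFiltration M.E → M.HasBoundedMinors S →
        S = M.activeFiltration := by
  have h := M.hasActiveChains_activeFiltration
  exact ⟨h.hasBoundedMinors.isConnectedFiltration h.isFiltration, h.hasBoundedMinors,
    fun S hS hB => (hB.hasActiveChains hS).unique h⟩
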